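/- **Setting.** Let $\sigma(v)=1/(1+e^{-v})$, $\sigma_\tau(v)=\sigma(\tau v)$, and for covariates $z_1,\dots,z_n\in\mathbb R^d$ and labels $y_1,\dots,y_n$ let $$\mathcal L_\tau(w)=\frac1n\sum_{i=1}^n\bigl(\sigma_\tau(\sigma^{-1}(y_i))-\sigma_\tau(z_i^\top w)\bigr)^2 .$$ AGGLIO (sigmoid, gradient descent) with temperature cap $\tau_{\max}$ starts from $w_0$ and $\tau_0$ and iterates $$w_{t+1}=w_t-\eta_t\nabla\mathcal L_{\tau_t}(w_t),\qquad \tau_{t+1}=\min\{\beta_t\tau_t,\,1,\,\tau_{\max}\}.$$ For $R,L>0$ and $\kappa\in(0,1]$, the parameters $(\tau_{\max},\tau_0,(\beta_t),(\eta_t),w_0)$ are called $(R,L,\kappa)$-admissible if $\|w_0\|_2\le R$, $0<\tau_0\le\min\{e^{-R}/(3R),1,\tau_{\max}\}$, and for all $t$: $1<\beta_t\le\exp\bigl(e^{-R}/(1+R)\bigr)$ and $\frac{\kappa}{\tau_t^2L}\le\eta_t\le\frac1{\tau_t^2L}$. Let $x_1,\dots,x_n\sim\mathcal N(0,I_d)$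 and real noise variables $\epsilon_1,\dots,\epsilon_n$ be all mutually independent, let $w_*\in\mathbb R^d$ be the gold model, and let $\varsigma>0$. **Theorem.** (1) *Pre-activation noise.* For every $R>0$ there are constants $a,N,c,K,M>0$ depending only on $R$ such that the following holds for all $n,d$ with $n\ge Nd$, all $\|w_*\|_2\le R$ and all $\varsigma>0$. Let $z_i=x_i$ and $y_i=\sigma(x_i^\top w_*+\epsilon_i)$, where each $\epsilon_i$ is $\varsigma$-sub-Gaussian, i.e. $\mathbb E\,e^{l\epsilon_i}\le e^{\varsigma^2l^2}$ for all $l\in\mathbb R$. Then with probability at least $1-e^{-cn}$: for all $\kappa\in(0,1]$ and all $(R,1+R,\kappa)$-admissible parameters with temperature cap $\tau_{\max}\le a/\varsigma$, and all integers $T\ge0$ with $T\ge\frac K\kappa\ln\frac1\varsigma$, $$\|w_T-w_*\|_2\le M\varsigma .$$ (2) *Post-activation noise.* There are universal constants $a,N,c,K,M>0$ such that the following holds for all $n,d$ with $n\ge Nd$, all $\|w_*\|_2\le1$ and all $0<\varsigma\le0.19$. Let $z_i=x_i/\sqrt d$ and $y_i=\sigma(z_i^\top w_*)+\epsilon_i$,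 where $\epsilon_i\in[-\varsigma,\varsigma]$ almost surely. Then with probability at least $1-n\,e^{-cd}$: all labels $y_i$ lie in $(0,1)$, and for all $\kappa\in(0,1]$ and all $(1,2/d,\kappa)$-admissible parameters with temperature cap $\tau_{\max}\le a/\varsigma$, and all integers $T\ge0$ with $T\ge\frac K\kappa\ln\frac1\varsigma$, $$\|w_T-w_*\|_2\le M\sqrt d\,\varsigma .$$ -/

import Mathlib

open MeasureTheory ProbabilityTheory

noncomputable section

namespace Agglio

/-- The inverse `y ↦ ln (y / (1 - y))` of the sigmoid on its range `(0, 1)`. -/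
def logit (y : ℝ) : ℝ := Real.log (y / (1 - y))

theorem logit_sigmoid (v : ℝ) : logit (Real.sigmoid v) = v := by
  have h : Real.sigmoid v / (1 - Real.sigmoid v) = Real.exp v := by
    rw [← Real.sigmoid_neg, ← Real.sigmoid_mul_rexp_neg, Real.exp_neg]
    have := (Real.sigmoid_pos v).ne'
    field_simp
  rw [logit, h, Real.log_exp]

theorem sigmoid_logit {y : ℝ} (h0 : 0 < y) (h1 : y < 1) : Real.sigmoid (logit y) = y := by
  have hy : y ∈ Set.range Real.sigmoid := by
    rw [Real.range_sigmoid]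
    exact ⟨h0, h1⟩
  obtain ⟨v, rfl⟩ := hy
  rw [logit_sigmoid]

/-- The `τ`-graduated sigmoid `σ_τ(v) = σ(τ v)` (for the sigmoid, which has bounded range, there is
no normalisation by `1 / τ`). -/
def gradSigmoid (τ v : ℝ) : ℝ := Real.sigmoid (τ * v)

/-- The graduated label `y^τ = σ_τ(σ⁻¹(y))`. -/
def gradLabel (τ y : ℝ) : ℝ := gradSigmoid τ (logit y)

/-- The graduated objective `L_τ(w) = (1/n) ∑ᵢ (yᵢ^τ - σ_τ(⟨xᵢ, w⟩))²`. -/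
def gradLoss {n d : ℕ} (x : Fin n → EuclideanSpace ℝ (Fin d)) (y : Fin n → ℝ) (τ : ℝ)
    (w : EuclideanSpace ℝ (Fin d)) : ℝ :=
  (1 / (n : ℝ)) * ∑ i, (gradLabel τ (y i) - gradSigmoid τ (inner ℝ (x i) w)) ^ 2

/-- The user-supplied parameters of a run of the algorithm in dimension `d`. -/
structure Params (d : ℕ) where
  /-- temperature cap -/
  τmax : ℝ
  /-- initial temperature -/
  τ₀ : ℝ
  /-- temperature increments `β_t` -/
  β : ℕ → ℝ
  /-- step lengths `η_t` -/
  η : ℕ → ℝ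
  /-- initial model -/
  w₀ : EuclideanSpace ℝ (Fin d)

/-- The temperatures: `τ_{t+1} = min {β_t τ_t, 1, τmax}`. -/
def Params.temp {d : ℕ} (p : Params d) : ℕ → ℝ
  | 0 => p.τ₀
  | t + 1 => min (p.β t * p.temp t) (min 1 p.τmax)

/-- The iterates (gradient descent steps): `w_{t+1} = w_t - η_t ∇L_{τ_t}(w_t)`. -/
def Params.iterate {d : ℕ} (p : Params d) {n : ℕ} (x : Fin n → EuclideanSpace ℝ (Fin d))
    (y : Fin n → ℝ) : ℕ → EuclideanSpace ℝ (Fin d)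
  | 0 => p.w₀
  | t + 1 => p.iterate x y t - p.η t • gradient (gradLoss x y (p.temp t)) (p.iterate x y t)

/-- Admissible parameters for gold models of norm at most `R`, where `τ² L` is the smoothness bound
used for the `τ`-graduated objective. The step length `η_t` is at most `1 / (τ_t² L)` and at least
`κ` times that value. -/
structure Params.Admissible {d : ℕ} (p : Params d) (R L κ : ℝ) : Prop where
  norm_w₀_le : ‖p.w₀‖ ≤ R
  τ₀_pos : 0 < p.τ₀
  τ₀_le : p.τ₀ ≤ Real.exp (-R) / (3 * R)
  τ₀_le_one : p.τ₀ ≤ 1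
  τ₀_le_τmax : p.τ₀ ≤ p.τmax
  one_lt_β : ∀ t, 1 < p.β t
  β_le : ∀ t, p.β t ≤ Real.exp (Real.exp (-R) / (1 + R))
  le_η : ∀ t, κ * (1 / (p.temp t ^ 2 * L)) ≤ p.η t
  η_le : ∀ t, p.η t ≤ 1 / (p.temp t ^ 2 * L)

/-- The covariates are i.i.d. standard Gaussian vectors, and the noise variables are mutually
independent and independent of the covariates. -/
structure IsGaussianDesign {Ω : Type*} [MeasurableSpace Ω] (P : Measure Ω) {n d : ℕ}
    (x : Fin n → Ω → EuclideanSpace ℝ (Fin d)) (ε : Fin n → Ω → ℝ) : Prop where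
  hasLaw : ∀ i, HasLaw (x i) (stdGaussian (EuclideanSpace ℝ (Fin d))) P
  aemeasurable : ∀ i, AEMeasurable (ε i) P
  indep : iIndepFun (fun i ω => (x i ω, ε i ω)) P
  indep_noise : ∀ i, IndepFun (x i) (ε i) P

/-- `ς`-sub-Gaussianity in the normalisation `E exp(l X) ≤ exp(ς² l²)` for all real `l`
(which forces `E X = 0`). -/
def IsSubGaussian {Ω : Type*} [MeasurableSpace Ω] (P : Measure Ω) (X : Ω → ℝ) (ς : ℝ) : Prop :=
  HasSubgaussianMGF X (Real.toNNReal (2 * ς ^ 2)) P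

/-- Labels with pre-activation noise: `yᵢ = σ(⟨xᵢ, w⟩ + εᵢ)`. -/
def preLabel {n d : ℕ} (x : Fin n → EuclideanSpace ℝ (Fin d)) (w : EuclideanSpace ℝ (Fin d))
    (ε : Fin n → ℝ) (i : Fin n) : ℝ :=
  Real.sigmoid (inner ℝ (x i) w + ε i)

/-- Labels with post-activation noise: `yᵢ = σ(⟨xᵢ, w⟩) + εᵢ`. -/
def postLabel {n d : ℕ} (x : Fin n → EuclideanSpace ℝ (Fin d)) (w : EuclideanSpace ℝ (Fin d))
    (ε : Fin n → ℝ) (i : Fin n) : ℝ :=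
  Real.sigmoid (inner ℝ (x i) w) + ε i

/-- Normalised covariates `xᵢ / √d`. -/
def normalised {n d : ℕ} (x : Fin n → EuclideanSpace ℝ (Fin d)) (i : Fin n) :
    EuclideanSpace ℝ (Fin d) :=
  (1 / Real.sqrt d) • x i

end Agglio

end

/-! Write each label as `σ(⟨x i, w*⟩ + e i)`. By the mean value theorem, the gradient of the
graduated loss at `w` is `τ²` times `(1/n) ∑ c i ⟨x i, w - w*⟩ x i` minus a noise vector, with
weights `0 ≤ c i ≤ 1/8`. A step of size `s / τ²` thus cancels the temperature: it contracts the
error by `1 - s l`, with `l` independent of `τ`, and adds at most `s D`, where `D` bounds the root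
mean square of the `e i`. Iterating, the error decays geometrically to the plateau `D / l`
(`GoodDesign.norm_iterate_sub_le`).

The weights are small only where `τ⟨x i, w⟩` or `τ⟨x i, w*⟩` is large. By Chebyshev this concerns
few indices as long as `τw` and `τw*` are bounded, and each such index costs at most 1 because
`GoodDesign` bounds truncated squares from below (`GoodDesign.weighted_lower`). The cap `τ ≤ a / ς`
keeps `τw` bounded even when the plateau is high.

Probability enters only to show that the design is good (Chernoff on a net,
`exists_measure_not_goodDesign_le`) and that the noise has mean square of order `ς²`.
Post-activation noise reduces to this setting: dividing the model by `√d` undoes the normalisation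
of the covariates, and while `|⟨x i, w*⟩| / √d ≤ 1` the labels stay away from 0 and 1, where `logit`
is Lipschitz. -/

namespace Agglio

/-! ### Gradient descent on a well-conditioned design -/

/-- A design whose second moment is bounded above and whose truncated second moment is bounded
below, uniformly over all directions. -/
structure GoodDesign {n d : ℕ} (x : Fin n → EuclideanSpace ℝ (Fin d)) (α : ℝ) : Prop where
  upper : ∀ u, ∑ i, (inner ℝ (x i) u) ^ 2 ≤ 8 * n * ‖u‖ ^ 2
  lower : ∀ u, ‖u‖ = 1 → α * n ≤ ∑ i, min ((inner ℝ (x i) u) ^ 2) 1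

theorem exists_sigmoid_sub_eq (a b : ℝ) : ∃ ξ ∈ Set.uIcc a b,
    Real.sigmoid b - Real.sigmoid a
      = Real.sigmoid ξ * (1 - Real.sigmoid ξ) * (b - a) := by
  rcases lt_trichotomy a b with h | h | h
  · obtain ⟨ξ, hξ, h'⟩ := exists_hasDerivAt_eq_slope Real.sigmoid _ h
      continuous_sigmoid.continuousOn fun v _ => Real.hasDerivAt_sigmoid v
    refine ⟨ξ, Set.Icc_subset_uIcc (Set.Ioo_subset_Icc_self hξ), ?_⟩
    rw [h', div_mul_cancel₀ _ (by linarith)]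
  · exact ⟨a, Set.left_mem_uIcc, by simp [h]⟩
  · obtain ⟨ξ, hξ, h'⟩ := exists_hasDerivAt_eq_slope Real.sigmoid _ h
      continuous_sigmoid.continuousOn fun v _ => Real.hasDerivAt_sigmoid v
    refine ⟨ξ, Set.Icc_subset_uIcc' (Set.Ioo_subset_Icc_self hξ), ?_⟩
    have : a - b ≠ 0 := by linarith
    rw [h']
    field_simp
    ring

theorem sigmoid_mul_one_sub_nonneg (v : ℝ) : 0 ≤ Real.sigmoid v * (1 - Real.sigmoid v) :=
  mul_nonneg (Real.sigmoid_nonneg v) (by linarith [Real.sigmoid_le_one v])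

theorem sigmoid_mul_one_sub_le (v : ℝ) : Real.sigmoid v * (1 - Real.sigmoid v) ≤ 1 / 4 := by
  nlinarith [sq_nonneg (Real.sigmoid v - 1 / 2)]

theorem sq_sigmoid_neg_le {v B : ℝ} (h : |v| ≤ B) :
    Real.sigmoid (-B) ^ 2 ≤ Real.sigmoid v * (1 - Real.sigmoid v) := by
  obtain ⟨h1, h2⟩ := abs_le.1 h
  rw [← Real.sigmoid_neg, sq]
  exact mul_le_mul (Real.sigmoid_le h1) (Real.sigmoid_le (by linarith))
    (Real.sigmoid_nonneg _) (Real.sigmoid_nonneg _)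

theorem abs_sigmoid_sub_le (a b : ℝ) : |Real.sigmoid b - Real.sigmoid a| ≤ 1 / 4 * |b - a| := by
  obtain ⟨ξ, -, h⟩ := exists_sigmoid_sub_eq a b
  rw [h, abs_mul, abs_of_nonneg (sigmoid_mul_one_sub_nonneg ξ)]
  exact mul_le_mul_of_nonneg_right (sigmoid_mul_one_sub_le ξ) (abs_nonneg _)

section

variable {n d : ℕ} {x : Fin n → EuclideanSpace ℝ (Fin d)}

theorem gradient_gradLoss (y : Fin n → ℝ) (τ : ℝ) (w : EuclideanSpace ℝ (Fin d)) :
    gradient (gradLoss x y τ) w = (1 / (n : ℝ)) • ∑ i,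
      (2 * τ * (Real.sigmoid (τ * inner ℝ (x i) w) * (1 - Real.sigmoid (τ * inner ℝ (x i) w)))
        * (Real.sigmoid (τ * inner ℝ (x i) w) - gradLabel τ (y i))) • x i := by
  refine HasGradientAt.gradient ?_
  rw [hasGradientAt_iff_hasFDerivAt]
  have hin : ∀ i, HasFDerivAt (fun w => τ * inner ℝ (x i) w) (τ • innerSL ℝ (x i)) w := fun i =>
    ((innerSL ℝ (x i)).hasFDerivAt).const_mul τ
  have hterm : ∀ i, HasFDerivAt
      (fun w => (gradLabel τ (y i) - gradSigmoid τ (inner ℝ (x i) w)) ^ 2) _ w := fun i =>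
    ((((Real.hasDerivAt_sigmoid _).comp_hasFDerivAt w (hin i)).const_sub
      (gradLabel τ (y i))).pow 2)
  have hsum := (HasFDerivAt.fun_sum (u := Finset.univ) fun i _ => hterm i).const_mul (1 / (n : ℝ))
  refine hsum.congr_fderiv (ContinuousLinearMap.ext fun v => ?_)
  simp only [InnerProductSpace.toDual_apply_apply, inner_smul_left, sum_inner,
    smul_apply, sum_apply, neg_apply,
    innerSL_apply_apply, smul_eq_mul, nsmul_eq_mul, conj_trivial, Function.comp]
  congr 1
  refine Finset.sum_congr rfl fun i _ => ?_
  norm_num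
  ring

/-- This is the upper design bound for the adjoint map: pair the sum with itself and apply
Cauchy–Schwarz. -/
theorem GoodDesign.norm_sum_smul_sq_le {α : ℝ} (hx : GoodDesign x α) (c : Fin n → ℝ) :
    ‖∑ i, c i • x i‖ ^ 2 ≤ 8 * n * ∑ i, c i ^ 2 := by
  set v := ∑ i, c i • x i with hv
  have h1 : ‖v‖ ^ 2 = ∑ i, c i * inner ℝ (x i) v := by
    rw [← real_inner_self_eq_norm_sq]
    nth_rewrite 1 [hv]
    simp [sum_inner, inner_smul_left]
  have h2 : (‖v‖ ^ 2) ^ 2 ≤ (∑ i, c i ^ 2) * (8 * n * ‖v‖ ^ 2) := by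
    rw [h1]
    refine (Finset.sum_mul_sq_le_sq_mul_sq _ _ _).trans ?_
    rw [← h1]
    exact mul_le_mul_of_nonneg_left (hx.upper v) (Finset.sum_nonneg fun _ _ => sq_nonneg _)
  rcases (sq_nonneg ‖v‖).eq_or_lt with h | h
  · rw [← h]
    exact mul_nonneg (by positivity) (Finset.sum_nonneg fun _ _ => sq_nonneg _)
  · exact le_of_mul_le_mul_right (by nlinarith) h

/-- Indices with `|⟨x i, p⟩| > B` number at most `8 n B₀² / B² ≤ α n / 4`, and likewise for `q`.
Discarding them costs at most 1 each in the truncated sum, which leaves `α n / 2` of the original `α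
n`. -/
theorem GoodDesign.weighted_lower {α B₀ B s : ℝ} (hx : GoodDesign x α) (hB : 0 < B)
    (hα : 32 * B₀ ^ 2 ≤ α * B ^ 2) {p q : EuclideanSpace ℝ (Fin d)} (hp : ‖p‖ ≤ B₀)
    (hq : ‖q‖ ≤ B₀) (hs : 0 ≤ s) {c : Fin n → ℝ} (hc : ∀ i, 0 ≤ c i)
    (hcs : ∀ i, |inner ℝ (x i) p| ≤ B → |inner ℝ (x i) q| ≤ B → s ≤ c i)
    (u : EuclideanSpace ℝ (Fin d)) :
    s * (α / 2) * n * ‖u‖ ^ 2 ≤ ∑ i, c i * (inner ℝ (x i) u) ^ 2 := by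
  have unit : ∀ u : EuclideanSpace ℝ (Fin d), ‖u‖ = 1 →
      s * (α / 2) * n ≤ ∑ i, c i * (inner ℝ (x i) u) ^ 2 := by
    intro u hu
    have key : ∀ i, s * (min ((inner ℝ (x i) u) ^ 2) 1
        - ((inner ℝ (x i) p) ^ 2 / B ^ 2 + (inner ℝ (x i) q) ^ 2 / B ^ 2))
        ≤ c i * (inner ℝ (x i) u) ^ 2 := by
      intro i
      have hB2 : 0 < B ^ 2 := by positivity
      have bad : ∀ r : ℝ, B < |r| → 1 ≤ r ^ 2 / B ^ 2 := fun r hr => by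
        rw [one_le_div hB2, ← sq_abs r]
        exact pow_le_pow_left₀ hB.le hr.le 2
      have hp' : 0 ≤ (inner ℝ (x i) p) ^ 2 / B ^ 2 := by positivity
      have hq' : 0 ≤ (inner ℝ (x i) q) ^ 2 / B ^ 2 := by positivity
      have hm := min_le_right ((inner ℝ (x i) u) ^ 2) 1
      have hR : 0 ≤ c i * (inner ℝ (x i) u) ^ 2 := mul_nonneg (hc i) (sq_nonneg _)
      by_cases h1 : |inner ℝ (x i) p| ≤ B
      · by_cases h2 : |inner ℝ (x i) q| ≤ B
        · calc _ ≤ s * (inner ℝ (x i) u) ^ 2 := by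
                refine mul_le_mul_of_nonneg_left ?_ hs
                linarith [min_le_left ((inner ℝ (x i) u) ^ 2) 1]
            _ ≤ _ := mul_le_mul_of_nonneg_right (hcs i h1 h2) (sq_nonneg _)
        · refine le_trans (mul_nonpos_of_nonneg_of_nonpos hs ?_) hR
          linarith [bad _ (not_le.1 h2)]
      · refine le_trans (mul_nonpos_of_nonneg_of_nonpos hs ?_) hR
        linarith [bad _ (not_le.1 h1)]
    refine le_trans ?_ (Finset.sum_le_sum fun i _ => key i)
    rw [← Finset.mul_sum, Finset.sum_sub_distrib, Finset.sum_add_distrib, ← Finset.sum_div,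
      ← Finset.sum_div, mul_assoc]
    refine mul_le_mul_of_nonneg_left ?_ hs
    have hquot : ∀ p : EuclideanSpace ℝ (Fin d), ‖p‖ ≤ B₀ →
        (∑ i, (inner ℝ (x i) p) ^ 2) / B ^ 2 ≤ α / 4 * n := by
      intro p hp
      rw [div_le_iff₀ (by positivity)]
      refine (hx.upper p).trans ?_
      have h1 : ‖p‖ ^ 2 ≤ B₀ ^ 2 := pow_le_pow_left₀ (norm_nonneg _) hp 2
      have hn : (0 : ℝ) ≤ n := n.cast_nonneg
      nlinarith [mul_le_mul_of_nonneg_left (h1.trans (by linarith : B₀ ^ 2 ≤ α * B ^ 2 / 32)) hn]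
    linarith [hx.lower u hu, hquot p hp, hquot q hq]
  rcases eq_or_ne u 0 with rfl | hu
  · simp
  · have hu' : 0 < ‖u‖ := norm_pos_iff.2 hu
    have h := unit (‖u‖⁻¹ • u) (by rw [norm_smul, norm_inv, norm_norm, inv_mul_cancel₀ hu'.ne'])
    have h' := mul_le_mul_of_nonneg_right h (sq_nonneg ‖u‖)
    refine h'.trans (le_of_eq ?_)
    rw [Finset.sum_mul]
    refine Finset.sum_congr rfl fun i _ => ?_
    rw [inner_smul_right]
    field_simp

/-- With `v` the weighted average and `Q = ⟨e, v⟩`, the bound 1/8 on the weights offsets the 8 of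
the design, giving `‖v‖² ≤ Q`. Hence `‖e - s v‖² ≤ ‖e‖² - s Q ≤ (1 - s l) ‖e‖²`, and `1 - s l ≤ (1 -
s l / 2)²`. -/
theorem GoodDesign.norm_sub_le {α l s : ℝ} (hx : GoodDesign x α) (hn : 0 < n)
    {c : Fin n → ℝ} (hc : ∀ i, 0 ≤ c i) (hc' : ∀ i, c i ≤ 1 / 8) (hs : 0 ≤ s) (hs1 : s ≤ 1)
    (hl : l ≤ 1) {e : EuclideanSpace ℝ (Fin d)}
    (he : l * n * ‖e‖ ^ 2 ≤ ∑ i, c i * (inner ℝ (x i) e) ^ 2) :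
    ‖e - s • (1 / (n : ℝ)) • ∑ i, (c i * inner ℝ (x i) e) • x i‖ ≤ (1 - s * l / 2) * ‖e‖ := by
  have hn' : (0 : ℝ) < n := by exact_mod_cast hn
  set Q := (1 / (n : ℝ)) * ∑ i, c i * (inner ℝ (x i) e) ^ 2 with hQ
  set v := (1 / (n : ℝ)) • ∑ i, (c i * inner ℝ (x i) e) • x i with hv
  have hQe : inner ℝ e v = Q := by
    rw [hv, hQ, inner_smul_right, inner_sum]
    congr 1
    refine Finset.sum_congr rfl fun i _ => ?_
    rw [inner_smul_right, real_inner_comm]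
    ring
  have hQl : l * ‖e‖ ^ 2 ≤ Q := by
    rw [hQ, one_div, inv_mul_eq_div, le_div_iff₀ hn']
    linarith
  have hvQ : ‖v‖ ^ 2 ≤ Q := by
    rw [hv, norm_smul, mul_pow, hQ]
    have h1 := hx.norm_sum_smul_sq_le fun i => c i * inner ℝ (x i) e
    have h2 : ∑ i, (c i * inner ℝ (x i) e) ^ 2
        ≤ 1 / 8 * ∑ i, c i * (inner ℝ (x i) e) ^ 2 := by
      rw [Finset.mul_sum]
      refine Finset.sum_le_sum fun i _ => ?_
      rw [mul_pow, sq (c i), mul_assoc]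
      exact mul_le_mul_of_nonneg_right (hc' i) (mul_nonneg (hc i) (sq_nonneg _))
    have h3 : ‖∑ i, (c i * inner ℝ (x i) e) • x i‖ ^ 2
        ≤ n * ∑ i, c i * (inner ℝ (x i) e) ^ 2 := by
      refine h1.trans ?_
      nlinarith
    rw [Real.norm_of_nonneg (by positivity)]
    calc (1 / (n : ℝ)) ^ 2 * ‖∑ i, (c i * inner ℝ (x i) e) • x i‖ ^ 2
        ≤ (1 / (n : ℝ)) ^ 2 * (n * ∑ i, c i * (inner ℝ (x i) e) ^ 2) := by gcongr
      _ = _ := by field_simp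
  have hQ0 : 0 ≤ Q := (sq_nonneg _).trans hvQ
  refine abs_le_of_sq_le_sq' ?_ (mul_nonneg (by nlinarith) (norm_nonneg _)) |>.2
  rw [norm_sub_sq_real, inner_smul_right, norm_smul, Real.norm_of_nonneg hs, hQe, mul_pow]
  have h1 : s ^ 2 * ‖v‖ ^ 2 ≤ s * Q := by
    have : s ^ 2 ≤ s := by nlinarith
    exact mul_le_mul this hvQ (sq_nonneg _) hs
  have h2 : s * (l * ‖e‖ ^ 2) ≤ s * Q := mul_le_mul_of_nonneg_left hQl hs
  nlinarith [sq_nonneg (s * l * ‖e‖)]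

/-- One gradient step contracts the error, up to the label noise. -/
theorem GoodDesign.norm_step_sub_le {α B₀ B τ s D : ℝ} (hx : GoodDesign x α) (hn : 0 < n)
    (hα : 0 ≤ α) (hα1 : α ≤ 1) (hB : 0 < B) (hαB : 32 * B₀ ^ 2 ≤ α * B ^ 2) (hτ : 0 < τ)
    (hs : 0 ≤ s) (hs1 : s ≤ 1) (hD : 0 ≤ D) {w wstar : EuclideanSpace ℝ (Fin d)}
    (hw : ‖τ • w‖ ≤ B₀) (hwstar : ‖τ • wstar‖ ≤ B₀) {y e : Fin n → ℝ}
    (hy : ∀ i, y i = Real.sigmoid (inner ℝ (x i) wstar + e i)) (he : ∑ i, e i ^ 2 ≤ n * D ^ 2) :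
    ‖w - (s / τ ^ 2) • gradient (gradLoss x y τ) w - wstar‖
      ≤ (1 - s * (Real.sigmoid (-B) ^ 4 * α) / 2) * ‖w - wstar‖ + s * D := by
  have hn' : (0 : ℝ) < n := by exact_mod_cast hn
  -- The slope `m` is `σ'` at a point between the two arguments, so it is bounded below whenever
  -- both arguments lie in `[-B, B]`.
  have hslope : ∀ i, ∃ m, 0 ≤ m ∧ m ≤ 1 / 4 ∧
      (|inner ℝ (x i) (τ • w)| ≤ B → |inner ℝ (x i) (τ • wstar)| ≤ B →
        Real.sigmoid (-B) ^ 2 ≤ m) ∧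
      Real.sigmoid (τ * inner ℝ (x i) w) - Real.sigmoid (τ * inner ℝ (x i) wstar)
        = m * (τ * inner ℝ (x i) (w - wstar)) := by
    intro i
    obtain ⟨ξ, hξ, h⟩ := exists_sigmoid_sub_eq (τ * inner ℝ (x i) wstar) (τ * inner ℝ (x i) w)
    refine ⟨_, sigmoid_mul_one_sub_nonneg ξ, sigmoid_mul_one_sub_le ξ, fun h1 h2 => ?_, ?_⟩
    · rw [inner_smul_right] at h1 h2
      refine sq_sigmoid_neg_le (abs_le.2 ?_)
      exact Set.uIcc_subset_Icc (abs_le.1 h2) (abs_le.1 h1) hξ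
    · rw [h, inner_sub_right]
      ring
  choose m hm0 hm1 hmB hm using hslope
  set g : Fin n → ℝ := fun i =>
    Real.sigmoid (τ * inner ℝ (x i) w) * (1 - Real.sigmoid (τ * inner ℝ (x i) w)) with hg
  -- The chain rule gives one factor `τ` and the slope another; both cancel against `s / τ²`. In `b`
  -- the slope factor is missing, but the label error is itself at most `τ |e i| / 4`.
  set c : Fin n → ℝ := fun i => 2 * g i * m i with hc
  set b : Fin n → ℝ := fun i => 2 * g i / τ *
    (gradLabel τ (y i) - Real.sigmoid (τ * inner ℝ (x i) wstar)) with hb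
  have hg0 : ∀ i, 0 ≤ g i := fun i => sigmoid_mul_one_sub_nonneg _
  have hg1 : ∀ i, g i ≤ 1 / 4 := fun i => sigmoid_mul_one_sub_le _
  have hc0 : ∀ i, 0 ≤ c i := fun i => mul_nonneg (mul_nonneg zero_le_two (hg0 i)) (hm0 i)
  have hc1 : ∀ i, c i ≤ 1 / 8 := fun i => by
    have := mul_le_mul (hg1 i) (hm1 i) (hm0 i) (by norm_num)
    simp only [hc]
    linarith
  have hcs : ∀ i, |inner ℝ (x i) (τ • w)| ≤ B → |inner ℝ (x i) (τ • wstar)| ≤ B →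
      2 * Real.sigmoid (-B) ^ 4 ≤ c i := fun i h1 h2 => by
    have hgi : Real.sigmoid (-B) ^ 2 ≤ g i :=
      sq_sigmoid_neg_le (by rwa [inner_smul_right] at h1)
    have := mul_le_mul hgi (hmB i h1 h2) (sq_nonneg _) (hg0 i)
    simp only [hc]
    linarith
  have hlow := hx.weighted_lower hB hαB hw hwstar (by positivity) hc0 hcs (w - wstar)
  have hsig : Real.sigmoid (-B) ^ 4 * α ≤ 1 :=
    mul_le_one₀ (pow_le_one₀ (Real.sigmoid_nonneg _) (Real.sigmoid_le_one _)) hα hα1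
  have hcontr := hx.norm_sub_le hn hc0 hc1 hs hs1 hsig (e := w - wstar)
    (by refine le_trans (le_of_eq ?_) hlow; ring)
  have hbe : ∀ i, b i ^ 2 ≤ 1 / 64 * e i ^ 2 := fun i => by
    have h1 : |b i| ≤ 1 / 8 * |e i| := by
      simp only [hb]
      rw [abs_mul, abs_of_nonneg (div_nonneg (mul_nonneg zero_le_two (hg0 i)) hτ.le), gradLabel,
        gradSigmoid, hy i, logit_sigmoid]
      have h2 := abs_sigmoid_sub_le (τ * inner ℝ (x i) wstar)
        (τ * (inner ℝ (x i) wstar + e i))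
      rw [← mul_sub, add_sub_cancel_left, abs_mul, abs_of_pos hτ] at h2
      calc _ ≤ 2 * (1 / 4) / τ * (1 / 4 * (τ * |e i|)) := by
            gcongr
            exact hg1 i
        _ = _ := by field_simp; ring
    have := pow_le_pow_left₀ (abs_nonneg _) h1 2
    rw [mul_pow, sq_abs, sq_abs] at this
    linarith
  have hnoise : ‖(1 / (n : ℝ)) • ∑ i, b i • x i‖ ≤ D := by
    refine abs_le_of_sq_le_sq' ?_ hD |>.2
    rw [norm_smul, mul_pow, Real.norm_of_nonneg (by positivity)]
    have h1 : ∑ i, b i ^ 2 ≤ 1 / 64 * (n * D ^ 2) := by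
      refine (Finset.sum_le_sum fun i _ => hbe i).trans ?_
      rw [← Finset.mul_sum]
      linarith
    calc (1 / (n : ℝ)) ^ 2 * ‖∑ i, b i • x i‖ ^ 2
        ≤ (1 / (n : ℝ)) ^ 2 * (8 * n * (1 / 64 * (n * D ^ 2))) := by
          gcongr
          refine (hx.norm_sum_smul_sq_le b).trans ?_
          gcongr
      _ = D ^ 2 / 8 := by field_simp; norm_num
      _ ≤ D ^ 2 := by linarith [sq_nonneg D]
  have hdecomp : w - (s / τ ^ 2) • gradient (gradLoss x y τ) w - wstar
      = ((w - wstar) - s • (1 / (n : ℝ)) • ∑ i, (c i * inner ℝ (x i) (w - wstar)) • x i)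
        + s • (1 / (n : ℝ)) • ∑ i, b i • x i := by
    have : (s / τ ^ 2) • gradient (gradLoss x y τ) w
        = s • (1 / (n : ℝ)) • ∑ i, (c i * inner ℝ (x i) (w - wstar)) • x i
          - s • (1 / (n : ℝ)) • ∑ i, b i • x i := by
      rw [gradient_gradLoss, ← smul_sub, ← smul_sub, ← Finset.sum_sub_distrib, div_eq_mul_inv,
        mul_smul, smul_comm (τ ^ 2)⁻¹, Finset.smul_sum]
      congr 2
      refine Finset.sum_congr rfl fun i _ => ?_
      rw [← sub_smul, smul_smul]
      congr 1
      have h1 : Real.sigmoid (τ * inner ℝ (x i) w) - gradLabel τ (y i)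
          = m i * (τ * inner ℝ (x i) (w - wstar))
            - (gradLabel τ (y i) - Real.sigmoid (τ * inner ℝ (x i) wstar)) := by
        rw [← hm i]
        ring
      simp only [hb, hc]
      rw [h1]
      simp only [hg]
      field_simp
    rw [this]
    abel
  rw [hdecomp]
  refine (norm_add_le _ _).trans (add_le_add hcontr ?_)
  rw [norm_smul, Real.norm_of_nonneg hs]
  exact mul_le_mul_of_nonneg_left hnoise hs

/-- The plateau `D / l` is the fixed point of `r ↦ (1 - s l) r + s D` for every `s`, so varying step
lengths do no harm. -/
theorem GoodDesign.norm_iterate_sub_le {α R E₀ B k D : ℝ} (hx : GoodDesign x α) (hn : 0 < n)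
    (hα : 0 < α) (hα1 : α ≤ 1) (hB : 0 < B)
    (hαB : 32 * (R + E₀ + 1) ^ 2 ≤ α * B ^ 2) {l : ℝ} (hl : l = Real.sigmoid (-B) ^ 4 * α / 2)
    (hD : 0 ≤ D) {wstar : EuclideanSpace ℝ (Fin d)} (hwstar : ‖wstar‖ ≤ R) {y e : Fin n → ℝ}
    (hy : ∀ i, y i = Real.sigmoid (inner ℝ (x i) wstar + e i)) (he : ∑ i, e i ^ 2 ≤ n * D ^ 2)
    {w : ℕ → EuclideanSpace ℝ (Fin d)} {τ s : ℕ → ℝ} (hτ : ∀ t, 0 < τ t) (hτ1 : ∀ t, τ t ≤ 1)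
    (hτD : ∀ t, τ t * (D / l) ≤ 1) (hk : 0 ≤ k) (hs : ∀ t, k ≤ s t) (hs1 : ∀ t, s t ≤ 1)
    (hw₀ : ‖w 0 - wstar‖ ≤ E₀)
    (hw : ∀ t, w (t + 1) = w t - (s t / τ t ^ 2) • gradient (gradLoss x y (τ t)) (w t)) (t : ℕ) :
    ‖w t - wstar‖ ≤ (1 - k * l) ^ t * E₀ + D / l := by
  have hσ := Real.sigmoid_pos (-B)
  have hl0 : 0 < l := by rw [hl]; positivity
  have hl1 : l ≤ 1 := by
    have : Real.sigmoid (-B) ^ 4 * α ≤ 1 :=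
      mul_le_one₀ (pow_le_one₀ hσ.le (Real.sigmoid_le_one _)) hα.le hα1
    linarith
  have hE₀ : 0 ≤ E₀ := (norm_nonneg _).trans hw₀
  have hk1 : k ≤ 1 := (hs 0).trans (hs1 0)
  have hkl0 : 0 ≤ 1 - k * l := by nlinarith
  have hkl1 : 1 - k * l ≤ 1 := by nlinarith
  induction t with
  | zero =>
    have : 0 ≤ D / l := by positivity
    simpa using by linarith
  | succ t ih =>
    have hs0 : 0 ≤ s t := hk.trans (hs t)
    have hpow : (1 - k * l) ^ t * E₀ ≤ E₀ := mul_le_of_le_one_left hE₀ (pow_le_one₀ hkl0 hkl1)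
    have hpow0 : 0 ≤ (1 - k * l) ^ t * E₀ := mul_nonneg (pow_nonneg hkl0 t) hE₀
    have h1 : ‖τ t • wstar‖ ≤ R + E₀ + 1 := by
      rw [norm_smul, Real.norm_of_nonneg (hτ t).le]
      linarith [mul_le_of_le_one_left (norm_nonneg wstar) (hτ1 t)]
    -- The induction hypothesis bounds `w t` by `R + E₀ + D / l`; the temperature cap turns the last
    -- term into 1.
    have h2 : ‖τ t • w t‖ ≤ R + E₀ + 1 := by
      rw [norm_smul, Real.norm_of_nonneg (hτ t).le]
      have h3 : ‖w t‖ ≤ R + E₀ + D / l := by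
        linarith [norm_le_norm_add_norm_sub wstar (w t), norm_sub_rev wstar (w t)]
      have h4 := mul_le_mul_of_nonneg_left h3 (hτ t).le
      have h5 : τ t * (R + E₀) ≤ R + E₀ :=
        mul_le_of_le_one_left (add_nonneg ((norm_nonneg _).trans hwstar) hE₀) (hτ1 t)
      linarith [hτD t]
    have hstep := hx.norm_step_sub_le hn hα.le hα1 hB hαB (hτ t) hs0 (hs1 t) hD h2 h1 hy he
    rw [hw t]
    refine hstep.trans ?_
    have h3 : 1 - s t * (Real.sigmoid (-B) ^ 4 * α) / 2 = 1 - s t * l := by rw [hl]; ring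
    rw [h3]
    have h4 : 0 ≤ 1 - s t * l := by nlinarith [hs1 t]
    have h5 : 1 - s t * l ≤ 1 - k * l := by nlinarith [hs t]
    calc (1 - s t * l) * ‖w t - wstar‖ + s t * D
        ≤ (1 - s t * l) * ((1 - k * l) ^ t * E₀ + D / l) + s t * D := by gcongr
      _ = (1 - s t * l) * ((1 - k * l) ^ t * E₀) + D / l := by field_simp; ring
      _ ≤ (1 - k * l) * ((1 - k * l) ^ t * E₀) + D / l := by gcongr
      _ = _ := by ring

end

/-! ### Nets of the sphere -/

/-- Volume comparison: disjoint balls of radius `ρ / 2` fit into the ball of radius `1 + ρ / 2`. -/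
theorem card_le_of_separated {E : Type*} [NormedAddCommGroup E] [NormedSpace ℝ E]
    [FiniteDimensional ℝ E] {ρ : ℝ} (hρ : 0 < ρ) (s : Finset E) (hs : ∀ c ∈ s, ‖c‖ ≤ 1)
    (h : ∀ c ∈ s, ∀ d ∈ s, c ≠ d → ρ ≤ ‖c - d‖) :
    (s.card : ℝ) ≤ ((2 + ρ) / ρ) ^ Module.finrank ℝ E := by
  borelize E
  let μ : Measure E := Measure.addHaar
  have D : Set.Pairwise (s : Set E) (Function.onFun Disjoint fun c => Metric.ball c (ρ / 2)) := by
    rintro c hc d hd hcd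
    refine Metric.ball_disjoint_ball ?_
    rw [dist_eq_norm, add_halves]
    exact h c hc d hd hcd
  have hsub : (⋃ c ∈ s, Metric.ball (c : E) (ρ / 2)) ⊆ Metric.ball (0 : E) (1 + ρ / 2) := by
    refine Set.iUnion₂_subset fun c hc => Metric.ball_subset_ball' ?_
    rw [dist_zero_right]
    linarith [hs c hc]
  have I : (s.card : ENNReal) * ENNReal.ofReal ((ρ / 2) ^ Module.finrank ℝ E)
        * μ (Metric.ball 0 1)
      ≤ ENNReal.ofReal ((1 + ρ / 2) ^ Module.finrank ℝ E) * μ (Metric.ball 0 1) := by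
    calc _ = μ (⋃ c ∈ s, Metric.ball (c : E) (ρ / 2)) := by
          rw [measure_biUnion_finset D fun c _ => measurableSet_ball]
          simp only [μ.addHaar_ball_of_pos _ (half_pos hρ), Finset.sum_const, nsmul_eq_mul,
            mul_assoc]
      _ ≤ μ (Metric.ball (0 : E) (1 + ρ / 2)) := measure_mono hsub
      _ = _ := μ.addHaar_ball_of_pos _ (by positivity)
  have J := (ENNReal.mul_le_mul_iff_left (Metric.measure_ball_pos _ _ zero_lt_one).ne'
    measure_ball_lt_top.ne).1 I
  have K := ENNReal.toReal_le_of_le_ofReal (by positivity) J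
  rw [ENNReal.toReal_mul, ENNReal.toReal_natCast, ENNReal.toReal_ofReal (by positivity),
    ← le_div_iff₀ (by positivity), ← div_pow] at K
  refine K.trans (le_of_eq ?_)
  congr 1
  field_simp

/-- A separated subset of the sphere of greatest cardinality is a net, since a far point could be
added to it. -/
theorem exists_sphere_net {E : Type*} [NormedAddCommGroup E] [NormedSpace ℝ E]
    [FiniteDimensional ℝ E] {ρ : ℝ} (hρ : 0 < ρ) : ∃ s : Finset E, (∀ v ∈ s, ‖v‖ = 1) ∧
      (∀ u : E, ‖u‖ = 1 → ∃ v ∈ s, ‖u - v‖ ≤ ρ) ∧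
      (s.card : ℝ) ≤ ((2 + ρ) / ρ) ^ Module.finrank ℝ E := by
  classical
  let p : ℕ → Prop := fun k => ∃ s : Finset E, (∀ v ∈ s, ‖v‖ = 1) ∧
    (∀ c ∈ s, ∀ d ∈ s, c ≠ d → ρ ≤ ‖c - d‖) ∧ s.card = k
  set b := ⌊((2 + ρ) / ρ) ^ Module.finrank ℝ E⌋₊ with hb
  have hcard : ∀ s : Finset E, (∀ v ∈ s, ‖v‖ = 1) →
      (∀ c ∈ s, ∀ d ∈ s, c ≠ d → ρ ≤ ‖c - d‖) → s.card ≤ b := fun s h1 h2 =>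
    Nat.le_floor (card_le_of_separated hρ s (fun c hc => (h1 c hc).le) h2)
  obtain ⟨s, h1, h2, h3⟩ : p (Nat.findGreatest p b) :=
    Nat.findGreatest_spec (Nat.zero_le b) ⟨∅, by simp⟩
  refine ⟨s, h1, fun u hu => ?_, card_le_of_separated hρ s (fun c hc => (h1 c hc).le) h2⟩
  by_contra! hfar
  have hus : u ∉ s := fun hus => by
    have := hfar u hus
    rw [sub_self, norm_zero] at this
    linarith
  have h1' : ∀ v ∈ insert u s, ‖v‖ = 1 := by
    intro v hv
    rcases Finset.mem_insert.1 hv with rfl | hv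
    exacts [hu, h1 v hv]
  have h2' : ∀ c ∈ insert u s, ∀ d ∈ insert u s, c ≠ d → ρ ≤ ‖c - d‖ := by
    intro c hc d hd hcd
    rcases Finset.mem_insert.1 hc with hc' | hc' <;> rcases Finset.mem_insert.1 hd with hd' | hd'
    · exact absurd (hc'.trans hd'.symm) hcd
    · rw [hc']
      exact (hfar d hd').le
    · rw [hd', norm_sub_rev]
      exact (hfar c hc').le
    · exact h2 c hc' d hd' hcd
  have hle : (insert u s).card ≤ Nat.findGreatest p b :=
    Nat.le_findGreatest (hcard _ h1' h2') ⟨_, h1', h2', rfl⟩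
  rw [Finset.card_insert_of_notMem hus] at hle
  omega

theorem opNorm_le_of_net {E F : Type*} [NormedAddCommGroup E] [NormedSpace ℝ E]
    [NormedAddCommGroup F] [NormedSpace ℝ F] (T : E →L[ℝ] F) {s : Finset E} {ρ K : ℝ}
    (hρ : ρ ≤ 1 / 2) (hK : 0 ≤ K) (hs : ∀ u : E, ‖u‖ = 1 → ∃ v ∈ s, ‖u - v‖ ≤ ρ)
    (h : ∀ v ∈ s, ‖T v‖ ≤ K) : ‖T‖ ≤ 2 * K := by
  have : ‖T‖ ≤ K + ‖T‖ / 2 := by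
    refine ContinuousLinearMap.opNorm_le_of_unit_norm (by positivity) fun u hu => ?_
    obtain ⟨v, hv, huv⟩ := hs u hu
    have h1 : T u = T v + T (u - v) := by rw [← map_add, add_sub_cancel]
    rw [h1]
    refine (norm_add_le _ _).trans (add_le_add (h v hv) ((T.le_opNorm _).trans ?_))
    rw [div_eq_mul_one_div]
    exact mul_le_mul_of_nonneg_left (huv.trans hρ) (norm_nonneg _)
  linarith

/-- Truncation makes the square 2-Lipschitz, so lower bounds pass from a net to the whole sphere. -/
theorem min_sq_one_le (a b : ℝ) : min (b ^ 2) 1 ≤ min (a ^ 2) 1 + 2 * |a - b| := by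
  have h0 := abs_nonneg (a - b)
  have h1 : |b| - |a| ≤ |a - b| := by
    rw [abs_sub_comm]
    exact abs_sub_abs_le_abs_sub b a
  have ha := abs_nonneg a
  have hb := abs_nonneg b
  rw [← sq_abs a, ← sq_abs b]
  rcases le_total (|a| ^ 2) 1 with h | h
  · rw [min_eq_left h]
    have ha1 : |a| ≤ 1 := (sq_le_one_iff₀ ha).1 h
    rcases le_total |b| 1 with hb1 | hb1
    · refine (min_le_left _ _).trans ?_
      nlinarith
    · refine (min_le_right _ _).trans ?_
      nlinarith
  · rw [min_eq_right h]
    linarith [min_le_right (|b| ^ 2) 1]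

/-- It is enough to test the two bounds of a good design on a net. -/
theorem goodDesign_of_net {n d : ℕ} {x : Fin n → EuclideanSpace ℝ (Fin d)} {α : ℝ} (hα : 0 < α)
    (hα1 : α ≤ 1) {s : Finset (EuclideanSpace ℝ (Fin d))}
    (hs : ∀ u : EuclideanSpace ℝ (Fin d), ‖u‖ = 1 → ∃ v ∈ s, ‖u - v‖ ≤ α / 6)
    (hup : ∀ v ∈ s, ∑ i, (inner ℝ (x i) v) ^ 2 ≤ 2 * n)
    (hlow : ∀ v ∈ s, 2 * α * n ≤ ∑ i, min ((inner ℝ (x i) v) ^ 2) 1) : GoodDesign x α := by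
  let T : EuclideanSpace ℝ (Fin d) →L[ℝ] EuclideanSpace ℝ (Fin n) := LinearMap.toContinuousLinearMap
    { toFun := fun u => WithLp.toLp 2 fun i => inner ℝ (x i) u
      map_add' := fun u v => by ext i; simp [inner_add_right]
      map_smul' := fun r u => by ext i; simp [inner_smul_right] }
  have hT : ∀ u, ‖T u‖ ^ 2 = ∑ i, (inner ℝ (x i) u) ^ 2 := fun u => by
    rw [EuclideanSpace.real_norm_sq_eq]
    rfl
  have hn : (0 : ℝ) ≤ n := n.cast_nonneg
  have hTn : ‖T‖ ≤ 2 * Real.sqrt (2 * n) := by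
    refine opNorm_le_of_net T (by linarith) (Real.sqrt_nonneg _) hs fun v hv => ?_
    refine Real.le_sqrt_of_sq_le ?_
    rw [hT]
    exact hup v hv
  have upper : ∀ u, ∑ i, (inner ℝ (x i) u) ^ 2 ≤ 8 * n * ‖u‖ ^ 2 := fun u => by
    rw [← hT]
    have h1 := pow_le_pow_left₀ (norm_nonneg _)
      ((T.le_opNorm u).trans (mul_le_mul_of_nonneg_right hTn (norm_nonneg u))) 2
    rw [mul_pow, mul_pow, Real.sq_sqrt (by positivity)] at h1
    linarith
  refine ⟨upper, fun u hu => ?_⟩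
  obtain ⟨v, hv, huv⟩ := hs u hu
  have h1 : 2 * α * n ≤ ∑ i, (min ((inner ℝ (x i) u) ^ 2) 1 + 2 * |inner ℝ (x i) (u - v)|) := by
    refine (hlow v hv).trans (Finset.sum_le_sum fun i _ => ?_)
    rw [inner_sub_right]
    exact min_sq_one_le _ _
  rw [Finset.sum_add_distrib, ← Finset.mul_sum] at h1
  -- By Cauchy–Schwarz and the upper bound, mesh `α / 6` gives `√8 α n / 6 ≤ α n / 2`; doubled, this
  -- uses up half of the `2 α n` available on the net.
  have h2 : ∑ i, |inner ℝ (x i) (u - v)| ≤ α / 2 * n := by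
    refine abs_le_of_sq_le_sq' ?_ (by positivity) |>.2
    have h3 := sq_sum_le_card_mul_sum_sq (s := Finset.univ)
      (f := fun i => |inner ℝ (x i) (u - v)|)
    simp only [sq_abs, Finset.card_univ, Fintype.card_fin] at h3
    refine h3.trans ((mul_le_mul_of_nonneg_left (upper _) hn).trans ?_)
    have h4 := pow_le_pow_left₀ (norm_nonneg _) huv 2
    calc (n : ℝ) * (8 * n * ‖u - v‖ ^ 2) ≤ n * (8 * n * (α / 6) ^ 2) := by gcongr
      _ ≤ _ := by nlinarith [mul_nonneg (sq_nonneg α) (mul_nonneg hn hn)]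
  linarith

/-! ### Concentration -/

section

variable {Ω : Type*} [MeasurableSpace Ω] {P : Measure Ω}

theorem lintegral_exp_sq_gaussianReal :
    ∫⁻ g, ENNReal.ofReal (Real.exp (g ^ 2 / 4)) ∂(gaussianReal 0 1)
      = ENNReal.ofReal (Real.sqrt 2) := by
  rw [gaussianReal_of_var_ne_zero 0 one_ne_zero,
    lintegral_withDensity_eq_lintegral_mul _ (measurable_gaussianPDF 0 1) (by fun_prop)]
  have h : ∀ g : ℝ, (gaussianPDF 0 1 * fun g => ENNReal.ofReal (Real.exp (g ^ 2 / 4))) g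
      = ENNReal.ofReal ((Real.sqrt (2 * Real.pi))⁻¹ * Real.exp (-(1 / 4) * g ^ 2)) := fun g => by
    rw [Pi.mul_apply, gaussianPDF, gaussianPDFReal, ← ENNReal.ofReal_mul (by positivity), mul_assoc,
      ← Real.exp_add]
    norm_num
    ring_nf
  simp_rw [h]
  rw [← ofReal_integral_eq_lintegral_ofReal
    ((integrable_exp_neg_mul_sq (by norm_num)).const_mul _)
    (Filter.Eventually.of_forall fun g => by positivity), integral_const_mul, integral_gaussian,
    ← Real.sqrt_inv, ← Real.sqrt_mul (by positivity)]
  congr 2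
  field_simp
  norm_num

/-- Linearise the square with an auxiliary Gaussian `g`: `exp(X² / (4c)) = E_g exp(r X g)` with `r²
= 1 / (2c)`. After exchanging the integrals, the sub-Gaussian bound leaves `E exp(g² / 4) = √2`. -/
theorem lintegral_exp_sq_le_of_hasSubgaussianMGF [IsProbabilityMeasure P] {X : Ω → ℝ}
    {c : NNReal} (hc : c ≠ 0) (hX : HasSubgaussianMGF X c P) :
    ∫⁻ ω, ENNReal.ofReal (Real.exp (X ω ^ 2 / (4 * c))) ∂P ≤ ENNReal.ofReal (Real.sqrt 2) := by
  have hc' : (0 : ℝ) < c := by positivity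
  have hXm : AEMeasurable X P := hX.aemeasurable
  set r := (Real.sqrt (2 * c))⁻¹ with hr
  have hr2 : r ^ 2 = (2 * (c : ℝ))⁻¹ := by rw [hr, inv_pow, Real.sq_sqrt (by positivity)]
  have h1 : ∀ ω, ENNReal.ofReal (Real.exp (X ω ^ 2 / (4 * c)))
      = ∫⁻ g, ENNReal.ofReal (Real.exp (X ω * r * g)) ∂(gaussianReal 0 1) := fun ω => by
    rw [← ofReal_integral_eq_lintegral_ofReal (integrable_exp_mul_gaussianReal _)
      (Filter.Eventually.of_forall fun g => by positivity)]
    have := congrFun (mgf_id_gaussianReal (μ := 0) (v := 1)) (X ω * r)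
    simp only [mgf, id] at this
    rw [this, mul_pow, hr2]
    congr 2
    simp only [NNReal.coe_one]
    field_simp
    ring
  simp_rw [h1]
  rw [lintegral_lintegral_swap, ← lintegral_exp_sq_gaussianReal]
  · refine lintegral_mono fun g => ?_
    have h2 : ∀ ω, X ω * r * g = (r * g) * X ω := fun ω => by ring
    simp_rw [h2]
    rw [← ofReal_integral_eq_lintegral_ofReal (hX.integrable_exp_mul _)
      (Filter.Eventually.of_forall fun g => by positivity)]
    refine ENNReal.ofReal_le_ofReal ((hX.mgf_le (r * g)).trans (le_of_eq ?_))
    rw [mul_pow, hr2]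
    congr 1
    field_simp
    ring
  · have : AEMeasurable (fun z : Ω × ℝ => X z.1) (P.prod (gaussianReal 0 1)) := hXm.comp_fst
    refine ENNReal.measurable_ofReal.comp_aemeasurable (Real.measurable_exp.comp_aemeasurable ?_)
    exact (this.mul_const r).mul measurable_snd.aemeasurable

/-- Chernoff's bound for sums of independent random variables. -/
theorem measure_le_sum_le {n : ℕ} {Z : Fin n → Ω → ℝ} (hZ : iIndepFun Z P)
    (hm : ∀ i, AEMeasurable (Z i) P) {q : ℝ} (hq : 0 ≤ q)
    (h : ∀ i, ∫⁻ ω, ENNReal.ofReal (Real.exp (Z i ω)) ∂P ≤ ENNReal.ofReal q) (a : ℝ) :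
    P {ω | a ≤ ∑ i, Z i ω} ≤ ENNReal.ofReal (Real.exp (-a) * q ^ n) := by
  let Y : Fin n → Ω → ENNReal := fun i ω => ENNReal.ofReal (Real.exp ((hm i).mk (Z i) ω))
  have hYm : ∀ i, Measurable (Y i) := fun i =>
    ENNReal.measurable_ofReal.comp (Real.measurable_exp.comp (hm i).measurable_mk)
  have hYi : iIndepFun Y P :=
    (hZ.congr fun i => (hm i).ae_eq_mk).comp (fun _ t => ENNReal.ofReal (Real.exp t))
      fun _ => by fun_prop
  have hYZ : ∀ i, Y i =ᵐ[P] fun ω => ENNReal.ofReal (Real.exp (Z i ω)) := fun i => by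
    filter_upwards [(hm i).ae_eq_mk] with ω hω
    simp only [Y, hω]
  have hprod : ∫⁻ ω, ∏ i, Y i ω ∂P ≤ ENNReal.ofReal (q ^ n) := by
    rw [lintegral_prod_eq_prod_lintegral_of_indepFun _ _ hYi hYm]
    calc ∏ i, ∫⁻ ω, Y i ω ∂P ≤ ∏ _i : Fin n, ENNReal.ofReal q := by
          refine Finset.prod_le_prod' fun i _ => ?_
          rw [lintegral_congr_ae (hYZ i)]
          exact h i
      _ = _ := by rw [Finset.prod_const, Finset.card_univ, Fintype.card_fin, ENNReal.ofReal_pow hq]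
  have hsub : ∀ᵐ ω ∂P, a ≤ ∑ i, Z i ω → ENNReal.ofReal (Real.exp a) ≤ ∏ i, Y i ω := by
    filter_upwards [ae_all_iff.2 hYZ] with ω hω ha
    simp only [hω]
    rw [← ENNReal.ofReal_prod_of_nonneg fun i _ => (Real.exp_pos _).le, ← Real.exp_sum]
    exact ENNReal.ofReal_le_ofReal (Real.exp_le_exp.2 ha)
  have hmarkov := mul_meas_ge_le_lintegral (μ := P)
    (Finset.measurable_prod Finset.univ fun i _ => hYm i) (ENNReal.ofReal (Real.exp a))
  calc P {ω | a ≤ ∑ i, Z i ω}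
      ≤ P {ω | ENNReal.ofReal (Real.exp a) ≤ ∏ i, Y i ω} := measure_mono_ae hsub
    _ = ENNReal.ofReal (Real.exp (-a)) * (ENNReal.ofReal (Real.exp a)
        * P {ω | ENNReal.ofReal (Real.exp a) ≤ ∏ i, Y i ω}) := by
        rw [← mul_assoc, ← ENNReal.ofReal_mul (Real.exp_pos _).le, ← Real.exp_add,
          neg_add_cancel, Real.exp_zero, ENNReal.ofReal_one, one_mul]
    _ ≤ ENNReal.ofReal (Real.exp (-a)) * ENNReal.ofReal (q ^ n) := by
        gcongr
        exact (by simpa using hmarkov : _ ≤ ∫⁻ ω, ∏ i, Y i ω ∂P).trans hprod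
    _ = _ := by rw [ENNReal.ofReal_mul (Real.exp_pos _).le]

theorem measure_le_sum_sq_le [IsProbabilityMeasure P] {n : ℕ} {X : Fin n → Ω → ℝ}
    (hX : iIndepFun X P) {c : NNReal} (hc : c ≠ 0) (h : ∀ i, HasSubgaussianMGF (X i) c P) :
    P {ω | 2 * c * n ≤ ∑ i, X i ω ^ 2} ≤ ENNReal.ofReal (Real.exp (-(3 / 20 * n))) := by
  have hc' : (0 : ℝ) < c := by positivity
  have hZ : iIndepFun (fun i ω => X i ω ^ 2 / (4 * c)) P :=
    hX.comp (fun _ t => t ^ 2 / (4 * c)) fun _ => by fun_prop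
  have hm : ∀ i, AEMeasurable (fun ω => X i ω ^ 2 / (4 * c)) P := fun i =>
    ((h i).aemeasurable.pow_const 2).div_const _
  have key := measure_le_sum_le hZ hm (Real.sqrt_nonneg 2)
    (fun i => lintegral_exp_sq_le_of_hasSubgaussianMGF hc (h i)) (n / 2)
  have hset : {ω | 2 * c * n ≤ ∑ i, X i ω ^ 2}
      = {ω | (n / 2 : ℝ) ≤ ∑ i, X i ω ^ 2 / (4 * c)} := by
    ext ω
    simp only [Set.mem_ofPred_eq]
    rw [← Finset.sum_div, le_div_iff₀ (by positivity)]
    ring_nf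
  rw [hset]
  refine key.trans (ENNReal.ofReal_le_ofReal ?_)
  have hs : Real.sqrt 2 = Real.exp (Real.log 2 / 2) := by
    rw [Real.sqrt_eq_rpow, Real.rpow_def_of_pos two_pos]
    ring_nf
  rw [hs, ← Real.exp_nat_mul, ← Real.exp_add]
  refine Real.exp_le_exp.2 ?_
  have hn : (0 : ℝ) ≤ n := n.cast_nonneg
  -- The exponent is `-n (1 - ln 2) / 2`, and `(1 - ln 2) / 2 > 0.15`.
  nlinarith [Real.log_two_lt_d9]

theorem hasLaw_inner {d : ℕ} {x : Ω → EuclideanSpace ℝ (Fin d)}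
    (hx : HasLaw x (stdGaussian (EuclideanSpace ℝ (Fin d))) P) (u : EuclideanSpace ℝ (Fin d)) :
    HasLaw (fun ω => inner ℝ (x ω) u) (gaussianReal 0 (‖u‖₊ ^ 2)) P := by
  refine ⟨(by fun_prop : Measurable fun v : EuclideanSpace ℝ (Fin d) =>
    (inner ℝ v u : ℝ)).comp_aemeasurable hx.aemeasurable, ?_⟩
  have h1 : (fun ω => (inner ℝ (x ω) u : ℝ)) = (innerSL ℝ u) ∘ x := by
    ext ω
    simp [real_inner_comm]
  rw [h1, ← AEMeasurable.map_map_of_aemeasurable (by fun_prop) hx.aemeasurable, hx.map_eq,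
    IsGaussian.map_eq_gaussianReal, integral_strongDual_stdGaussian, variance_dual_stdGaussian,
    innerSL_apply_norm]
  congr 1
  rw [Real.toNNReal_pow (norm_nonneg u), norm_toNNReal]

theorem hasSubgaussianMGF_inner {d : ℕ} {x : Ω → EuclideanSpace ℝ (Fin d)}
    (hx : HasLaw x (stdGaussian (EuclideanSpace ℝ (Fin d))) P) {u : EuclideanSpace ℝ (Fin d)}
    {c : NNReal} (hu : ‖u‖ ^ 2 ≤ c) : HasSubgaussianMGF (fun ω => inner ℝ (x ω) u) c P := by
  have h := hasLaw_inner hx u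
  refine ⟨fun t => ?_, fun t => ?_⟩
  · have h1 : Integrable (fun g => Real.exp (t * g)) (P.map fun ω => inner ℝ (x ω) u) := by
      rw [h.map_eq]
      exact integrable_exp_mul_gaussianReal t
    exact h1.comp_aemeasurable h.aemeasurable
  · rw [mgf_gaussianReal h.map_eq]
    refine Real.exp_le_exp.2 ?_
    simp only [zero_mul, zero_add, NNReal.coe_pow, coe_nnnorm]
    gcongr

/-- Since `min(g², 1) > 0` almost surely, the integral is below 1 and a small `α` exists. The 4
leaves Chernoff the rate `2 α` at the threshold `2 α n`. -/
theorem exists_lintegral_exp_neg_min_le : ∃ α : ℝ, 0 < α ∧ α ≤ 1 ∧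
    ∫⁻ g, ENNReal.ofReal (Real.exp (-min (g ^ 2) 1)) ∂(gaussianReal 0 1)
      ≤ ENNReal.ofReal (Real.exp (-(4 * α))) := by
  set f : ℝ → ENNReal := fun g => ENNReal.ofReal (Real.exp (-min (g ^ 2) 1)) with hf
  have hf1 : ∀ g, f g ≤ 1 := fun g => by
    rw [hf, ← ENNReal.ofReal_one]
    refine ENNReal.ofReal_le_ofReal (Real.exp_le_one_iff.2 ?_)
    have : 0 ≤ min (g ^ 2) 1 := le_min (sq_nonneg g) zero_le_one
    linarith
  have hlt : ∫⁻ g, f g ∂(gaussianReal 0 1) < 1 := by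
    have h0 : ∫⁻ _g, (1 : ENNReal) ∂(gaussianReal 0 1) = 1 := by simp
    rw [← h0]
    refine lintegral_strict_mono (IsProbabilityMeasure.ne_zero _) aemeasurable_const ?_ ?_
    · exact ((lintegral_mono hf1).trans_lt (by rw [h0]; exact ENNReal.one_lt_top)).ne
    · have := nullSingletonClass_gaussianReal (μ := 0) (v := 1) one_ne_zero
      have hne : ∀ᵐ g ∂(gaussianReal 0 1), g ≠ 0 := by
        rw [ae_iff]
        simp
      filter_upwards [hne] with g hg
      rw [hf, ← ENNReal.ofReal_one]
      refine (ENNReal.ofReal_lt_ofReal_iff one_pos).2 (Real.exp_lt_one_iff.2 ?_)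
      have : 0 < min (g ^ 2) 1 := lt_min (by positivity) zero_lt_one
      linarith
  set I := ∫⁻ g, f g ∂(gaussianReal 0 1) with hI
  have hlim : Filter.Tendsto (fun α : ℝ => ENNReal.ofReal (Real.exp (-(4 * α))))
      (nhdsWithin 0 (Set.Ioi 0)) (nhds 1) := by
    have : Continuous fun α : ℝ => ENNReal.ofReal (Real.exp (-(4 * α))) :=
      ENNReal.continuous_ofReal.comp (by fun_prop)
    have h := this.tendsto 0
    simp only [mul_zero, neg_zero, Real.exp_zero, ENNReal.ofReal_one] at h
    exact h.mono_left nhdsWithin_le_nhds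
  obtain ⟨α, h1, h2⟩ := ((hlim.eventually (lt_mem_nhds hlt)).and
    (Ioo_mem_nhdsGT (zero_lt_one (α := ℝ)))).exists
  exact ⟨α, h2.1, h2.2.le, h1.le⟩

/-- Gaussian designs are good with overwhelming probability. -/
theorem exists_measure_not_goodDesign_le : ∃ α N c : ℝ, 0 < α ∧ α ≤ 1 ∧ 0 < N ∧ 0 < c ∧
    ∀ (n d : ℕ), N * d ≤ n → ∀ (Ω : Type*) [MeasurableSpace Ω] (P : Measure Ω)
      [IsProbabilityMeasure P] (x : Fin n → Ω → EuclideanSpace ℝ (Fin d)),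
      (∀ i, HasLaw (x i) (stdGaussian (EuclideanSpace ℝ (Fin d))) P) → iIndepFun x P →
      P {ω | ¬ GoodDesign (fun i => x i ω) α} ≤ ENNReal.ofReal (2 * Real.exp (-(c * n))) := by
  obtain ⟨α, hα, hα1, hI⟩ := exists_lintegral_exp_neg_min_le
  set C : ℝ := (2 + α / 6) / (α / 6) with hC
  have hC1 : 1 ≤ C := by
    rw [hC, one_le_div (by positivity)]
    linarith
  -- Half of the rate valid at a single net point: the other half pays for the net, whose size `C ^
  -- d` is at most `exp(c n)` once `n ≥ (log C / c) d`.
  set c : ℝ := min (3 / 20) (2 * α) / 2 with hc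
  have hc0 : 0 < c := by positivity
  have hlog : 0 ≤ Real.log C := Real.log_nonneg hC1
  refine ⟨α, Real.log C / c + 1, c, hα, hα1, by positivity, hc0, ?_⟩
  intro n d hnd Ω _ P _ x hx hind
  have hn : (0 : ℝ) ≤ n := n.cast_nonneg
  have hd : (0 : ℝ) ≤ d := d.cast_nonneg
  obtain ⟨s, hs1, hs, hcard⟩ := exists_sphere_net (E := EuclideanSpace ℝ (Fin d))
    (ρ := α / 6) (by positivity)
  rw [finrank_euclideanSpace_fin, ← hC] at hcard
  set A : EuclideanSpace ℝ (Fin d) → Set Ω :=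
    fun v => {ω | 2 * (1 : NNReal) * n ≤ ∑ i, (inner ℝ (x i ω) v) ^ 2} with hA
  set B : EuclideanSpace ℝ (Fin d) → Set Ω :=
    fun v => {ω | -(2 * α * n) ≤ ∑ i, -min ((inner ℝ (x i ω) v) ^ 2) 1} with hB
  have hAP : ∀ v ∈ s, P (A v) ≤ ENNReal.ofReal (Real.exp (-(2 * c * n))) := fun v hv => by
    refine (measure_le_sum_sq_le (X := fun i ω => inner ℝ (x i ω) v)
      (hind.comp (fun _ t => inner ℝ t v) fun _ => by fun_prop) one_ne_zero
      fun i => hasSubgaussianMGF_inner (hx i) (by simp [hs1 v hv])).trans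
      (ENNReal.ofReal_le_ofReal (Real.exp_le_exp.2 ?_))
    have : 2 * c ≤ 3 / 20 := by rw [hc]; linarith [min_le_left (3 / 20) (2 * α)]
    nlinarith
  have hBP : ∀ v ∈ s, P (B v) ≤ ENNReal.ofReal (Real.exp (-(2 * c * n))) := fun v hv => by
    refine (measure_le_sum_le (Z := fun i ω => -min ((inner ℝ (x i ω) v) ^ 2) 1)
      (hind.comp (fun _ t => -min ((inner ℝ t v) ^ 2) 1) fun _ => by fun_prop)
      (fun i => (by fun_prop : Measurable fun t : EuclideanSpace ℝ (Fin d) =>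
        -min ((inner ℝ t v : ℝ) ^ 2) 1).comp_aemeasurable (hx i).aemeasurable)
      (Real.exp_pos (-(4 * α))).le (fun i => ?_) _).trans (ENNReal.ofReal_le_ofReal ?_)
    · have h := hasLaw_inner (hx i) v
      have h1 : ‖v‖₊ ^ 2 = 1 := by
        rw [← NNReal.coe_inj]
        simp [hs1 v hv]
      rw [h1] at h
      rw [← h.map_eq, lintegral_map' (by fun_prop) h.aemeasurable] at hI
      exact hI
    · rw [← Real.exp_nat_mul, ← Real.exp_add]
      refine Real.exp_le_exp.2 ?_
      have : 2 * c ≤ 2 * α := by rw [hc]; linarith [min_le_right (3 / 20) (2 * α)]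
      nlinarith
  have hsub : {ω | ¬ GoodDesign (fun i => x i ω) α} ⊆ ⋃ v ∈ s, (A v ∪ B v) := by
    intro ω hω
    by_contra hcon
    simp only [Set.mem_iUnion, not_exists, Set.mem_union, not_or] at hcon
    refine hω (goodDesign_of_net hα hα1 hs (fun v hv => ?_) fun v hv => ?_)
    · have := (hcon v hv).1
      simp only [hA, Set.mem_ofPred_eq, not_le, NNReal.coe_one] at this
      linarith
    · have := (hcon v hv).2
      simp only [hB, Set.mem_ofPred_eq, not_le, Finset.sum_neg_distrib] at this
      linarith
  have hCd : (s.card : ℝ) ≤ Real.exp (c * n) := by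
    refine hcard.trans ?_
    rw [← Real.exp_log (by linarith : 0 < C), ← Real.exp_nat_mul]
    refine Real.exp_le_exp.2 ?_
    have : Real.log C / c * d ≤ n := by linarith
    rw [div_mul_eq_mul_div, div_le_iff₀ hc0] at this
    linarith
  calc P {ω | ¬ GoodDesign (fun i => x i ω) α}
      ≤ P (⋃ v ∈ s, (A v ∪ B v)) := measure_mono hsub
    _ ≤ ∑ v ∈ s, P (A v ∪ B v) := measure_biUnion_finset_le _ _
    _ ≤ ∑ _v ∈ s, ENNReal.ofReal (2 * Real.exp (-(2 * c * n))) := by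
        refine Finset.sum_le_sum fun v hv => (measure_union_le _ _).trans ?_
        rw [two_mul (Real.exp _), ENNReal.ofReal_add (by positivity) (by positivity)]
        exact add_le_add (hAP v hv) (hBP v hv)
    _ = ENNReal.ofReal (s.card * (2 * Real.exp (-(2 * c * n)))) := by
        rw [Finset.sum_const, nsmul_eq_mul, ENNReal.ofReal_mul (Nat.cast_nonneg _),
          ENNReal.ofReal_natCast]
    _ ≤ _ := by
        refine ENNReal.ofReal_le_ofReal ?_
        calc (s.card : ℝ) * (2 * Real.exp (-(2 * c * n)))
            ≤ Real.exp (c * n) * (2 * Real.exp (-(2 * c * n))) := by gcongr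
          _ = 2 * (Real.exp (c * n) * Real.exp (-(2 * c * n))) := by ring
          _ = _ := by
            rw [← Real.exp_add]
            ring_nf

end

/-! ### Convergence of the algorithm -/

section

variable {n d : ℕ}

theorem Params.Admissible.temp_pos {p : Params d} {R L κ : ℝ} (h : p.Admissible R L κ) (t : ℕ) :
    0 < p.temp t := by
  induction t with
  | zero => exact h.τ₀_pos
  | succ t ih =>
    exact lt_min (mul_pos (zero_lt_one.trans (h.one_lt_β t)) ih)
      (lt_min zero_lt_one (h.τ₀_pos.trans_le h.τ₀_le_τmax))

theorem Params.Admissible.temp_le_one {p : Params d} {R L κ : ℝ} (h : p.Admissible R L κ)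
    (t : ℕ) : p.temp t ≤ 1 := by
  cases t with
  | zero => exact h.τ₀_le_one
  | succ t => exact (min_le_right _ _).trans (min_le_left _ _)

theorem Params.Admissible.temp_le_τmax {p : Params d} {R L κ : ℝ} (h : p.Admissible R L κ)
    (t : ℕ) : p.temp t ≤ p.τmax := by
  cases t with
  | zero => exact h.τ₀_le_τmax
  | succ t => exact (min_le_right _ _).trans (min_le_right _ _)

end

/-- Gradient descent on the graduated objectives of a good design reaches the noise level. -/
theorem exists_norm_iterate_sub_le {α R L D₀ : ℝ} (hα : 0 < α) (hα1 : α ≤ 1) (hR : 0 < R)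
    (hL : 1 ≤ L) (hD₀ : 0 < D₀) : ∃ a K M : ℝ, 0 < a ∧ 0 < K ∧ 0 < M ∧
    ∀ (n d : ℕ), 0 < n → ∀ (x : Fin n → EuclideanSpace ℝ (Fin d)), GoodDesign x α →
      ∀ (wstar : EuclideanSpace ℝ (Fin d)) (ς : ℝ), ‖wstar‖ ≤ R → 0 < ς →
      ∀ (y e : Fin n → ℝ), (∀ i, y i = Real.sigmoid (inner ℝ (x i) wstar + e i)) →
      ∑ i, e i ^ 2 ≤ n * (D₀ * ς) ^ 2 →
      ∀ (κ : ℝ) (w : ℕ → EuclideanSpace ℝ (Fin d)) (τ s : ℕ → ℝ), 0 < κ → κ ≤ 1 →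
      (∀ t, 0 < τ t) → (∀ t, τ t ≤ 1) → (∀ t, τ t ≤ a / ς) → (∀ t, κ / L ≤ s t) →
      (∀ t, s t ≤ 1) → ‖w 0‖ ≤ R →
      (∀ t, w (t + 1) = w t - (s t / τ t ^ 2) • gradient (gradLoss x y (τ t)) (w t)) →
      ∀ T : ℕ, K / κ * Real.log (1 / ς) ≤ T → ‖w T - wstar‖ ≤ M * ς := by
  -- Here `2 * R` bounds the initial error.
  set B := Real.sqrt (32 * (R + 2 * R + 1) ^ 2 / α) with hB
  have hB0 : 0 < B := Real.sqrt_pos.2 (by positivity)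
  have hαB : 32 * (R + 2 * R + 1) ^ 2 ≤ α * B ^ 2 := by
    rw [hB, Real.sq_sqrt (by positivity), mul_div_cancel₀ _ hα.ne']
  have hσ := Real.sigmoid_pos (-B)
  obtain ⟨l, hl⟩ : ∃ l, l = Real.sigmoid (-B) ^ 4 * α / 2 := ⟨_, rfl⟩
  have hl0 : 0 < l := by rw [hl]; positivity
  have hL0 : 0 < L := by linarith
  -- The cap gives `τ D / l ≤ 1` for `D = D₀ ς`; the number of steps gives `(1 - κ l / L) ^ T ≤ ς`;
  -- the last constant adds the decayed initial error to the plateau.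
  refine ⟨l / D₀, L / l, 2 * R + D₀ / l, by positivity, by positivity, by positivity, ?_⟩
  intro n d hn x hx wstar ς hwstar hς y e hy he κ w τ s hκ hκ1 hτ hτ1 hτa hs hs1 hw₀ hw T hT
  have hτD : ∀ t, τ t * (D₀ * ς / l) ≤ 1 := fun t => by
    refine (mul_le_mul_of_nonneg_right (hτa t) (by positivity)).trans (le_of_eq ?_)
    field_simp
  have hE₀ : ‖w 0 - wstar‖ ≤ 2 * R := (norm_sub_le _ _).trans (by linarith)
  have key := hx.norm_iterate_sub_le hn hα hα1 hB0 hαB hl (by positivity) hwstar hy he hτ hτ1 hτD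
    (by positivity : 0 ≤ κ / L) hs hs1 hE₀ hw T
  have hpow : (1 - κ / L * l) ^ T ≤ ς := by
    have h1 : 0 ≤ 1 - κ / L * l := by
      have h2 : κ / L ≤ 1 := (hs 0).trans (hs1 0)
      have h3 : l ≤ 1 := by
        have : Real.sigmoid (-B) ^ 4 * α ≤ 1 :=
          mul_le_one₀ (pow_le_one₀ hσ.le (Real.sigmoid_le_one _)) hα.le hα1
        linarith
      linarith [mul_le_one₀ h2 hl0.le h3]
    calc (1 - κ / L * l) ^ T ≤ Real.exp (-(κ / L * l)) ^ T :=
          pow_le_pow_left₀ h1 (Real.one_sub_le_exp_neg _) T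
      _ = Real.exp (T * -(κ / L * l)) := (Real.exp_nat_mul _ _).symm
      _ ≤ Real.exp (Real.log ς) := by
          refine Real.exp_le_exp.2 ?_
          rw [one_div, Real.log_inv] at hT
          have h4 := mul_le_mul_of_nonneg_left hT (by positivity : 0 ≤ κ / L * l)
          have h5 : κ / L * l * (L / l / κ * -Real.log ς) = -Real.log ς := by field_simp
          rw [h5] at h4
          linarith
      _ = ς := Real.exp_log hς
  calc ‖w T - wstar‖ ≤ _ := key
    _ ≤ ς * (2 * R) + D₀ * ς / l := by gcongr
    _ = _ := by ring

theorem three_mul_exp_neg_le {c m : ℝ} (hc : 0 < c) (h : 4 / c ≤ m) :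
    3 * Real.exp (-(c * m)) ≤ Real.exp (-(c / 2 * m)) := by
  have h1 : 4 ≤ c * m := by rwa [div_le_iff₀' hc] at h
  have h2 : (3 : ℝ) ≤ Real.exp (c / 2 * m) := by
    linarith [Real.add_one_le_exp (c / 2 * m)]
  calc 3 * Real.exp (-(c * m)) ≤ Real.exp (c / 2 * m) * Real.exp (-(c * m)) := by gcongr
    _ = _ := by
      rw [← Real.exp_add]
      ring_nf

theorem recovery_of_preactivation_noise (R : ℝ) (hR : 0 < R) :
    ∃ a N c K M : ℝ, 0 < a ∧ 0 < N ∧ 0 < c ∧ 0 < K ∧ 0 < M ∧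
      ∀ (n d : ℕ), N * d ≤ n →
      ∀ (Ω : Type*) [MeasurableSpace Ω] (P : Measure Ω) [IsProbabilityMeasure P]
        (x : Fin n → Ω → EuclideanSpace ℝ (Fin d)) (ε : Fin n → Ω → ℝ)
        (wstar : EuclideanSpace ℝ (Fin d)) (ς : ℝ),
        IsGaussianDesign P x ε → ‖wstar‖ ≤ R → 0 < ς →
        (∀ i, IsSubGaussian P (ε i) ς) →
        P {ω | ¬ ∀ (κ : ℝ) (p : Params d), 0 < κ → κ ≤ 1 →
              p.τmax ≤ a / ς → p.Admissible R (1 + R) κ →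
              ∀ T : ℕ, K / κ * Real.log (1 / ς) ≤ T →
                ‖p.iterate (fun i => x i ω)
                    (preLabel (fun i => x i ω) wstar (fun i => ε i ω)) T - wstar‖
                  ≤ M * ς}
          ≤ ENNReal.ofReal (Real.exp (-(c * n))) := by
  obtain ⟨α, N, c, hα, hα1, hN, hc, hgood⟩ := exists_measure_not_goodDesign_le
  obtain ⟨a, K, M, ha, hK, hM, hconv⟩ :=
    exists_norm_iterate_sub_le hα hα1 hR (by linarith : 1 ≤ 1 + R) two_pos
  set c₁ := min c (3 / 20) with hc₁
  have hc₁0 : 0 < c₁ := by positivity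
  refine ⟨a, N + 4 / c₁, c₁ / 2, K, M, ha, by positivity, by positivity, hK, hM, ?_⟩
  intro n d hnd Ω _ P _ x ε wstar ς hdes hwstar hς hε
  -- For `d = 0` the sample size may be zero, but all vectors vanish. For `d ≥ 1` the summand `4 /
  -- c₁` forces `n ≥ 4 / c₁`, enough to absorb the prefactor 3 of the failure probability.
  rcases Nat.eq_zero_or_pos d with rfl | hd
  · have : ∀ v : EuclideanSpace ℝ (Fin 0), ‖v‖ ≤ M * ς := fun v => by
      rw [Subsingleton.elim v 0, norm_zero]
      positivity
    simp [this]
  have hd1 : (1 : ℝ) ≤ d := by exact_mod_cast hd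
  have hn0 : (0 : ℝ) ≤ n := n.cast_nonneg
  have hc4 : 0 < 4 / c₁ := by positivity
  have hn4 : 4 / c₁ ≤ n := by nlinarith
  have hn : 0 < n := by
    have : (0 : ℝ) < n := hc4.trans_le hn4
    exact_mod_cast this
  set v : NNReal := Real.toNNReal (2 * ς ^ 2) with hv
  have hvς : (v : ℝ) = 2 * ς ^ 2 := Real.coe_toNNReal _ (by positivity)
  have hv0 : v ≠ 0 := by
    rw [← NNReal.coe_ne_zero, hvς]
    positivity
  have hA := hgood n d (by nlinarith) Ω P x hdes.hasLaw
    (hdes.indep.comp (fun _ z => z.1) fun _ => measurable_fst)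
  have hB := measure_le_sum_sq_le (hdes.indep.comp (fun _ z => z.2) fun _ => measurable_snd)
    hv0 hε
  set A := {ω | ¬ GoodDesign (fun i => x i ω) α}
  set B := {ω | 2 * (v : ℝ) * n ≤ ∑ i, ((fun z : EuclideanSpace ℝ (Fin d) × ℝ => z.2) ∘
    fun ω => (x i ω, ε i ω)) ω ^ 2} with hBdef
  calc P _ ≤ P (A ∪ B) := by
        refine measure_mono fun ω hω => ?_
        by_contra hcon
        simp only [Set.mem_union, not_or] at hcon
        have hgω : GoodDesign (fun i => x i ω) α := not_not.1 hcon.1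
        have hεω : ∑ i, ε i ω ^ 2 ≤ n * (2 * ς) ^ 2 := by
          have h1 := hcon.2
          simp only [hBdef, Set.mem_ofPred_eq, not_le, Function.comp] at h1
          rw [hvς] at h1
          linarith
        refine hω fun κ p hκ hκ1 hpa hp T hT => ?_
        have hτ := hp.temp_pos
        refine hconv n d hn _ hgω wstar ς hwstar hς _ (fun i => ε i ω) (fun i => rfl) hεω κ
          (p.iterate _ _) p.temp (fun t => p.η t * p.temp t ^ 2) hκ hκ1 hτ hp.temp_le_one
          (fun t => (hp.temp_le_τmax t).trans hpa) (fun t => ?_) (fun t => ?_) hp.norm_w₀_le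
          (fun t => ?_) T hT
        · have h1 := mul_le_mul_of_nonneg_right (hp.le_η t) (sq_nonneg (p.temp t))
          refine le_trans (le_of_eq ?_) h1
          have := (hτ t).ne'
          field_simp
        · have h1 := mul_le_mul_of_nonneg_right (hp.η_le t) (sq_nonneg (p.temp t))
          refine h1.trans ?_
          have := (hτ t).ne'
          have h2 : 1 / (p.temp t ^ 2 * (1 + R)) * p.temp t ^ 2 = 1 / (1 + R) := by field_simp
          rw [h2, div_le_one (by positivity)]
          linarith
        · rw [mul_div_cancel_right₀ _ (pow_ne_zero 2 (hτ t).ne')]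
          rfl
    _ ≤ P A + P B := measure_union_le _ _
    _ ≤ ENNReal.ofReal (2 * Real.exp (-(c * n))) + ENNReal.ofReal (Real.exp (-(3 / 20 * n))) :=
        add_le_add hA hB
    _ = ENNReal.ofReal (2 * Real.exp (-(c * n)) + Real.exp (-(3 / 20 * n))) :=
        (ENNReal.ofReal_add (by positivity) (by positivity)).symm
    _ ≤ _ := by
        refine ENNReal.ofReal_le_ofReal (le_trans ?_ (three_mul_exp_neg_le hc₁0 hn4))
        have h1 : Real.exp (-(c * n)) ≤ Real.exp (-(c₁ * n)) :=
          Real.exp_le_exp.2 (neg_le_neg (mul_le_mul_of_nonneg_right (min_le_left _ _) hn0))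
        have h2 : Real.exp (-(3 / 20 * n)) ≤ Real.exp (-(c₁ * n)) :=
          Real.exp_le_exp.2 (neg_le_neg (mul_le_mul_of_nonneg_right (min_le_right _ _) hn0))
        linarith

/-! ### Bounded noise after the activation -/

theorem sigmoid_mem_Icc {v : ℝ} (hv : |v| ≤ 1) : Real.sigmoid v ∈ Set.Icc (1 / 4 : ℝ) (3 / 4) := by
  have h := abs_sigmoid_sub_le 0 v
  rw [sub_zero, Real.sigmoid_zero] at h
  obtain ⟨h1, h2⟩ := abs_le.1 (h.trans (by linarith : 1 / 4 * |v| ≤ 1 / 4))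
  constructor <;> linarith

theorem sigmoid_add_mem_Icc {v ε : ℝ} (hv : |v| ≤ 1) (hε : |ε| ≤ 0.19) :
    Real.sigmoid v + ε ∈ Set.Icc (0.06 : ℝ) 0.94 := by
  obtain ⟨h1, h2⟩ := sigmoid_mem_Icc hv
  obtain ⟨h3, h4⟩ := abs_le.1 hε
  constructor <;> linarith

/-- Moderate noise in the label amounts to comparable noise before the activation. -/
theorem abs_logit_sigmoid_add_sub_le {v ε : ℝ} (hv : |v| ≤ 1) (hε : |ε| ≤ 0.19) :
    |logit (Real.sigmoid v + ε) - v| ≤ 300 * |ε| := by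
  obtain ⟨h1, h2⟩ := sigmoid_add_mem_Icc hv hε
  obtain ⟨h3, h4⟩ := sigmoid_mem_Icc hv
  obtain ⟨ξ, hξ, h⟩ := exists_sigmoid_sub_eq v (logit (Real.sigmoid v + ε))
  have hy := sigmoid_logit (by linarith) (by linarith : Real.sigmoid v + ε < 1)
  have hξ' : Real.sigmoid ξ ∈ Set.Icc (0.06 : ℝ) 0.94 := by
    have h5 := Real.sigmoid_monotone.image_uIcc_subset (Set.mem_image_of_mem _ hξ)
    rw [hy] at h5
    exact Set.uIcc_subset_Icc ⟨by linarith, by linarith⟩ ⟨h1, h2⟩ h5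
  rw [hy, add_sub_cancel_left] at h
  -- The left side is a crude lower bound for `0.06 * 0.94 = 0.0564`.
  have hlow : 1 / 300 ≤ Real.sigmoid ξ * (1 - Real.sigmoid ξ) := by
    nlinarith [mul_nonneg (sub_nonneg.2 hξ'.1) (sub_nonneg.2 hξ'.2)]
  have h6 : |ε| = Real.sigmoid ξ * (1 - Real.sigmoid ξ) * |logit (Real.sigmoid v + ε) - v| := by
    rw [← abs_of_nonneg (sigmoid_mul_one_sub_nonneg ξ), ← abs_mul, ← h]
  have h7 := mul_le_mul_of_nonneg_right hlow (abs_nonneg (logit (Real.sigmoid v + ε) - v))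
  linarith

/-- Consequently, a run on normalised covariates, divided by `√d`, is a run on the Gaussian
covariates with step lengths divided by `d`. -/
theorem gradient_gradLoss_normalised {n d : ℕ} (x : Fin n → EuclideanSpace ℝ (Fin d))
    (y : Fin n → ℝ) (τ : ℝ) (w : EuclideanSpace ℝ (Fin d)) :
    gradient (gradLoss (normalised x) y τ) w
      = (1 / Real.sqrt d) • gradient (gradLoss x y τ) ((1 / Real.sqrt d) • w) := by
  rw [gradient_gradLoss, gradient_gradLoss, smul_comm (1 / Real.sqrt d)]
  simp only [normalised, inner_smul_left, inner_smul_right, conj_trivial, Finset.smul_sum]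
  refine Finset.sum_congr rfl fun i _ => ?_
  congr 1
  exact smul_comm _ _ _

/-- The inner product has variance at most `1 / d`. The union over all samples produces the factor
`n` in the failure probability. -/
theorem measure_one_lt_abs_inner_le {Ω : Type*} [MeasurableSpace Ω] {P : Measure Ω}
    [IsProbabilityMeasure P] {d : ℕ} (hd : 0 < d) {x : Ω → EuclideanSpace ℝ (Fin d)}
    (hx : HasLaw x (stdGaussian (EuclideanSpace ℝ (Fin d))) P) {u : EuclideanSpace ℝ (Fin d)}
    (hu : ‖u‖ ^ 2 ≤ 1 / d) :
    P {ω | 1 < |(inner ℝ (x ω) u : ℝ)|} ≤ ENNReal.ofReal (2 * Real.exp (-(1 / 2 * d))) := by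
  have hd' : (0 : ℝ) < d := by exact_mod_cast hd
  have hX : HasSubgaussianMGF (fun ω => inner ℝ (x ω) u) (1 / d : NNReal) P :=
    hasSubgaussianMGF_inner hx (by push_cast; exact hu)
  have htail : ∀ Y : Ω → ℝ, HasSubgaussianMGF Y (1 / d : NNReal) P →
      P {ω | 1 ≤ Y ω} ≤ ENNReal.ofReal (Real.exp (-(1 / 2 * d))) := fun Y hY => by
    have h := hY.measure_ge_le zero_le_one
    rw [← ofReal_measureReal]
    refine ENNReal.ofReal_le_ofReal (h.trans (le_of_eq ?_))
    push_cast
    congr 1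
    field_simp
  have hsub : {ω | 1 < |(inner ℝ (x ω) u : ℝ)|}
      ⊆ {ω | 1 ≤ (inner ℝ (x ω) u : ℝ)} ∪ {ω | 1 ≤ (-fun ω => (inner ℝ (x ω) u : ℝ)) ω} := by
    intro ω hω
    rcases lt_abs.1 (show 1 < |(inner ℝ (x ω) u : ℝ)| from hω) with h | h
    exacts [Or.inl h.le, Or.inr h.le]
  refine (measure_mono hsub).trans ((measure_union_le _ _).trans ?_)
  rw [two_mul (Real.exp _), ENNReal.ofReal_add (by positivity) (by positivity)]
  exact add_le_add (htail _ hX) (htail _ hX.neg)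

theorem recovery_of_postactivation_noise :
    ∃ a N c K M : ℝ, 0 < a ∧ 0 < N ∧ 0 < c ∧ 0 < K ∧ 0 < M ∧
      ∀ (n d : ℕ), N * d ≤ n →
      ∀ (Ω : Type*) [MeasurableSpace Ω] (P : Measure Ω) [IsProbabilityMeasure P]
        (x : Fin n → Ω → EuclideanSpace ℝ (Fin d)) (ε : Fin n → Ω → ℝ)
        (wstar : EuclideanSpace ℝ (Fin d)) (ς : ℝ),
        IsGaussianDesign P x ε → ‖wstar‖ ≤ 1 → 0 < ς → ς ≤ 0.19 →
        (∀ i, ∀ᵐ ω ∂P, ε i ω ∈ Set.Icc (-ς) ς) →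
        P {ω | ¬ ((∀ i, postLabel (normalised fun i => x i ω) wstar
                    (fun i => ε i ω) i ∈ Set.Ioo (0 : ℝ) 1) ∧
              ∀ (κ : ℝ) (p : Params d), 0 < κ → κ ≤ 1 →
              p.τmax ≤ a / ς → p.Admissible 1 (2 / d) κ →
              ∀ T : ℕ, K / κ * Real.log (1 / ς) ≤ T →
                ‖p.iterate (normalised fun i => x i ω)
                    (postLabel (normalised fun i => x i ω) wstar
                      (fun i => ε i ω)) T - wstar‖
                  ≤ M * (Real.sqrt d * ς))}
          ≤ ENNReal.ofReal (n * Real.exp (-(c * d))) := by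
  obtain ⟨α, N, c, hα, hα1, hN, hc, hgood⟩ := exists_measure_not_goodDesign_le
  obtain ⟨a, K, M, ha, hK, hM, hconv⟩ :=
    exists_norm_iterate_sub_le hα hα1 one_pos one_le_two (by norm_num : (0 : ℝ) < 300)
  set c₁ := min c (1 / 2) with hc₁
  have hc₁0 : 0 < c₁ := by positivity
  refine ⟨a, N + 4, c₁ / 2, K, M, ha, by positivity, by positivity, hK, hM, ?_⟩
  intro n d hnd Ω _ P _ x ε wstar ς hdes hwstar hς hς1 hε
  rcases Nat.eq_zero_or_pos d with rfl | hd
  · rcases Nat.eq_zero_or_pos n with rfl | hn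
    · have : ∀ v : EuclideanSpace ℝ (Fin 0), ‖v‖ = 0 := fun v => by
        rw [Subsingleton.elim v 0, norm_zero]
      simp [this]
    · refine prob_le_one.trans ?_
      rw [← ENNReal.ofReal_one]
      refine ENNReal.ofReal_le_ofReal ?_
      simpa using Nat.one_le_iff_ne_zero.2 hn.ne'
  have hd1 : (1 : ℝ) ≤ d := by exact_mod_cast hd
  have hd0 : (0 : ℝ) < d := by linarith
  have hn4 : (4 : ℝ) ≤ n := by nlinarith
  have hn : 0 < n := by
    have : (0 : ℝ) < n := by linarith
    exact_mod_cast this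
  -- In the first case the claimed bound exceeds 1, as `n ≥ 4`. In the second, half of the exponent
  -- absorbs the constant 4.
  rcases lt_or_ge 1 (4 * Real.exp (-(c₁ / 2 * d))) with hsmall | hlarge
  · refine prob_le_one.trans ?_
    rw [← ENNReal.ofReal_one]
    refine ENNReal.ofReal_le_ofReal (hsmall.le.trans ?_)
    gcongr
  set r := Real.sqrt d with hr
  have hr0 : 0 < r := Real.sqrt_pos.2 hd0
  have hr2 : r ^ 2 = d := Real.sq_sqrt hd0.le
  set u := (1 / r) • wstar with hu
  have hu2 : ‖u‖ ^ 2 ≤ 1 / d := by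
    rw [hu, norm_smul, mul_pow, Real.norm_of_nonneg (by positivity), div_pow, one_pow, hr2]
    exact mul_le_of_le_one_right (by positivity) (pow_le_one₀ (norm_nonneg _) hwstar)
  have hu1 : ‖u‖ ≤ 1 := by
    refine (sq_le_one_iff₀ (norm_nonneg _)).1 (hu2.trans ?_)
    rwa [div_le_one hd0]
  have hA := hgood n d (by nlinarith) Ω P x hdes.hasLaw
    (hdes.indep.comp (fun _ z => z.1) fun _ => measurable_fst)
  have hB := fun i => measure_one_lt_abs_inner_le hd (hdes.hasLaw i) hu2
  set A := {ω | ¬ GoodDesign (fun i => x i ω) α}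
  set B : Fin n → Set Ω := fun i => {ω | 1 < |(inner ℝ (x i ω) u : ℝ)|}
  have hlabel : ∀ ω i, postLabel (normalised fun i => x i ω) wstar (fun i => ε i ω) i
      = Real.sigmoid (inner ℝ (x i ω) u) + ε i ω := fun ω i => by
    simp only [postLabel, normalised, hu, inner_smul_left, inner_smul_right, conj_trivial, hr]
  calc P _ ≤ P (A ∪ ⋃ i, B i) := by
        refine measure_mono_ae ?_
        filter_upwards [ae_all_iff.2 hε] with ω hεω hω
        change ω ∈ A ∪ ⋃ i, B i
        by_contra hcon
        simp only [Set.mem_union, Set.mem_iUnion, not_or, not_exists] at hcon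
        have hgω : GoodDesign (fun i => x i ω) α := not_not.1 hcon.1
        have hxω : ∀ i, |(inner ℝ (x i ω) u : ℝ)| ≤ 1 := fun i => not_lt.1 (hcon.2 i)
        have hες : ∀ i, |ε i ω| ≤ ς := fun i => abs_le.2 (hεω i)
        have hy01 : ∀ i, postLabel (normalised fun i => x i ω) wstar (fun i => ε i ω) i
            ∈ Set.Ioo (0 : ℝ) 1 := fun i => by
          rw [hlabel]
          obtain ⟨h1, h2⟩ := sigmoid_add_mem_Icc (hxω i) ((hες i).trans hς1)
          constructor <;> linarith
        refine hω ⟨hy01, fun κ p hκ hκ1 hpa hp T hT => ?_⟩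
        have hτ := hp.temp_pos
        set y := postLabel (normalised fun i => x i ω) wstar (fun i => ε i ω) with hy
        -- The differences `logit (y i) - ⟨x i, u⟩` act as pre-activation noise for the rescaled
        -- gold model `u`.
        have he : ∑ i, (logit (y i) - inner ℝ (x i ω) u) ^ 2 ≤ n * (300 * ς) ^ 2 := by
          calc _ ≤ ∑ _i : Fin n, (300 * ς) ^ 2 := by
                refine Finset.sum_le_sum fun i _ => ?_
                rw [← sq_abs, hy, hlabel]
                refine pow_le_pow_left₀ (abs_nonneg _) ?_ 2
                refine (abs_logit_sigmoid_add_sub_le (hxω i) ((hες i).trans hς1)).trans ?_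
                linarith [hες i]
            _ = _ := by simp
        have key := hconv n d hn _ hgω u ς hu1 hς y
          (fun i => logit (y i) - inner ℝ (x i ω) u)
          (fun i => by rw [add_sub_cancel, sigmoid_logit (hy01 i).1 (hy01 i).2]) he κ
          (fun t => (1 / r) • p.iterate (normalised fun i => x i ω) y t) p.temp
          (fun t => p.η t * p.temp t ^ 2 / d) hκ hκ1 hτ hp.temp_le_one
          (fun t => (hp.temp_le_τmax t).trans hpa) (fun t => ?_) (fun t => ?_) ?_
          (fun t => ?_) T hT
        · have h1 : p.iterate (normalised fun i => x i ω) y T - wstar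
              = r • ((1 / r) • p.iterate (normalised fun i => x i ω) y T - u) := by
            rw [hu, ← smul_sub, smul_smul, mul_one_div_cancel hr0.ne', one_smul]
          rw [h1, norm_smul, Real.norm_of_nonneg hr0.le]
          calc _ ≤ r * (M * ς) := by gcongr
            _ = _ := by ring
        · have h1 := mul_le_mul_of_nonneg_right (hp.le_η t) (sq_nonneg (p.temp t))
          rw [le_div_iff₀ hd0]
          refine le_trans (le_of_eq ?_) h1
          have := (hτ t).ne'
          field_simp
        · have h1 := mul_le_mul_of_nonneg_right (hp.η_le t) (sq_nonneg (p.temp t))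
          rw [div_le_one hd0]
          refine h1.trans ?_
          have := (hτ t).ne'
          have h2 : 1 / (p.temp t ^ 2 * (2 / d)) * p.temp t ^ 2 = d / 2 := by field_simp
          rw [h2]
          linarith
        · rw [norm_smul, Real.norm_of_nonneg (by positivity)]
          have h1 : 1 ≤ r := by
            rw [hr]
            exact Real.one_le_sqrt.2 hd1
          exact mul_le_one₀ (by rwa [div_le_one hr0]) (norm_nonneg _) hp.norm_w₀_le
        · change (1 / r) • (p.iterate (normalised fun i => x i ω) y t
            - p.η t • gradient (gradLoss (normalised fun i => x i ω) y (p.temp t))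
              (p.iterate (normalised fun i => x i ω) y t)) = _
          rw [gradient_gradLoss_normalised, ← hr, smul_sub, smul_smul, smul_smul]
          congr 2
          have := (hτ t).ne'
          rw [← hr2]
          field_simp
    _ ≤ P A + P (⋃ i, B i) := measure_union_le _ _
    _ ≤ P A + ∑ i, P (B i) := by
        gcongr
        exact measure_iUnion_fintype_le _ _
    _ ≤ ENNReal.ofReal (2 * Real.exp (-(c * n)))
        + ∑ _i : Fin n, ENNReal.ofReal (2 * Real.exp (-(1 / 2 * d))) :=
        add_le_add hA (Finset.sum_le_sum fun i _ => hB i)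
    _ = ENNReal.ofReal (2 * Real.exp (-(c * n)) + n * (2 * Real.exp (-(1 / 2 * d)))) := by
        rw [Finset.sum_const, Finset.card_univ, Fintype.card_fin, nsmul_eq_mul,
          ENNReal.ofReal_add (by positivity) (by positivity),
          ENNReal.ofReal_mul (p := (n : ℝ)) n.cast_nonneg, ENNReal.ofReal_natCast]
    _ ≤ _ := by
        refine ENNReal.ofReal_le_ofReal ?_
        have hdn : (d : ℝ) ≤ n := by nlinarith
        have h1 : Real.exp (-(c * n)) ≤ Real.exp (-(c₁ * d)) := by
          refine Real.exp_le_exp.2 (neg_le_neg ?_)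
          exact mul_le_mul (min_le_left _ _) hdn hd0.le hc.le
        have h2 : Real.exp (-(1 / 2 * d)) ≤ Real.exp (-(c₁ * d)) :=
          Real.exp_le_exp.2 (neg_le_neg (mul_le_mul_of_nonneg_right (min_le_right _ _) hd0.le))
        have h3 : Real.exp (-(c₁ * d)) = Real.exp (-(c₁ / 2 * d)) * Real.exp (-(c₁ / 2 * d)) := by
          rw [← Real.exp_add]
          ring_nf
        have hpos := Real.exp_pos (-(c₁ / 2 * d))
        calc 2 * Real.exp (-(c * n)) + n * (2 * Real.exp (-(1 / 2 * d)))
            ≤ n * (2 * Real.exp (-(c₁ * d))) + n * (2 * Real.exp (-(c₁ * d))) := by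
              refine add_le_add ?_ (by gcongr)
              have : 0 < Real.exp (-(c₁ * d)) := Real.exp_pos _
              nlinarith
          _ = n * (4 * Real.exp (-(c₁ / 2 * d)) * Real.exp (-(c₁ / 2 * d))) := by rw [h3]; ring
          _ ≤ n * (1 * Real.exp (-(c₁ / 2 * d))) := by gcongr
          _ = _ := by ring

end Agglio

theorem mainTheorem3 :
    -- pre-activation sub-Gaussian noise; the constants depend on `R` only
    (∀ R : ℝ, 0 < R →
      ∃ a N c K M : ℝ, 0 < a ∧ 0 < N ∧ 0 < c ∧ 0 < K ∧ 0 < M ∧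
        ∀ (n d : ℕ), N * d ≤ n →
        ∀ (Ω : Type*) [MeasurableSpace Ω] (P : Measure Ω) [IsProbabilityMeasure P]
          (x : Fin n → Ω → EuclideanSpace ℝ (Fin d)) (ε : Fin n → Ω → ℝ)
          (wstar : EuclideanSpace ℝ (Fin d)) (ς : ℝ),
          Agglio.IsGaussianDesign P x ε → ‖wstar‖ ≤ R → 0 < ς →
          (∀ i, Agglio.IsSubGaussian P (ε i) ς) →
          P {ω | ¬ ∀ (κ : ℝ) (p : Agglio.Params d), 0 < κ → κ ≤ 1 →
                p.τmax ≤ a / ς → p.Admissible R (1 + R) κ →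
                ∀ T : ℕ, K / κ * Real.log (1 / ς) ≤ T →
                  ‖p.iterate (fun i => x i ω)
                      (Agglio.preLabel (fun i => x i ω) wstar (fun i => ε i ω)) T - wstar‖
                    ≤ M * ς}
            ≤ ENNReal.ofReal (Real.exp (-(c * n)))) ∧
    -- post-activation bounded noise, normalised covariates, `R = 1`; the constants are universal
    (∃ a N c K M : ℝ, 0 < a ∧ 0 < N ∧ 0 < c ∧ 0 < K ∧ 0 < M ∧
        ∀ (n d : ℕ), N * d ≤ n →
        ∀ (Ω : Type*) [MeasurableSpace Ω] (P : Measure Ω) [IsProbabilityMeasure P]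
          (x : Fin n → Ω → EuclideanSpace ℝ (Fin d)) (ε : Fin n → Ω → ℝ)
          (wstar : EuclideanSpace ℝ (Fin d)) (ς : ℝ),
          Agglio.IsGaussianDesign P x ε → ‖wstar‖ ≤ 1 → 0 < ς → ς ≤ 0.19 →
          (∀ i, ∀ᵐ ω ∂P, ε i ω ∈ Set.Icc (-ς) ς) →
          P {ω | ¬ ((∀ i, Agglio.postLabel (Agglio.normalised fun i => x i ω) wstar
                      (fun i => ε i ω) i ∈ Set.Ioo (0 : ℝ) 1) ∧
                ∀ (κ : ℝ) (p : Agglio.Params d), 0 < κ → κ ≤ 1 →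
                p.τmax ≤ a / ς → p.Admissible 1 (2 / d) κ →
                ∀ T : ℕ, K / κ * Real.log (1 / ς) ≤ T →
                  ‖p.iterate (Agglio.normalised fun i => x i ω)
                      (Agglio.postLabel (Agglio.normalised fun i => x i ω) wstar
                        (fun i => ε i ω)) T - wstar‖
                    ≤ M * (Real.sqrt d * ς))}
            ≤ ENNReal.ofReal (n * Real.exp (-(c * d)))) :=
  ⟨Agglio.recovery_of_preactivation_noise, Agglio.recovery_of_postactivation_noise⟩
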